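/- A $\mathrm{CAT}(0)$ cube complex $X$ is a simply connected cubical complex all of whose vertex links are flag; it is identified with its vertex set and carries the path metric $d$ of its $1$-skeleton. A halfspace is a side of a hyperplane; $\mathfrak h^*$ denotes the complement of $\mathfrak h$; halfspaces $\mathfrak h,\mathfrak k$ are transverse if $\mathfrak h\cap\mathfrak k$, $\mathfrak h^*\cap\mathfrak k$, $\mathfrak h\cap\mathfrak k^*$, $\mathfrak h^*\cap\mathfrak k^*$ are all nonempty, and strongly separated if they are disjoint and no halfspace is transverse to both. The Roller compactification $\overline X$ is the set of ultrafilters of halfspaces $\sigma_x$ (sets of pairwise intersecting halfspaces containing a side of every hyperplane), with the topology of pointwise convergence; a vertex $v$ is identified with $\sigma_v=\{\mathfrak h : v\in\mathfrak h\}$, and $\partial X=\overline X\setminus X$. A point $x\in\partial X$ is regular, $x\in\partial_{\rm reg}X$, if $\sigma_x$ contains a chain $\mathfrak h_0\supsetneq\mathfrak h_1\supsetneq\cdots$ with $\mathfrak h_n^*$ and $\mathfrak h_{n+1}$ strongly separated for all $n$. A set $\mathcal A\subseteq\partial X$ is ample if for all $k\ge1$ and all pairwise transverse halfspaces $\mathfrak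 h_1,\dots,\mathfrak h_k$ there is $x\in\mathcal A$ with $\mathfrak h_1,\dots,\mathfrak h_k\in\sigma_x$. For $x,y,z\in\overline X$ let $I(x,y)=\{u\in\overline X : \sigma_x\cap\sigma_y\subseteq\sigma_u\}$, and let $m(x,y,z)$ be the median, the unique point of $I(x,y)\cap I(y,z)\cap I(z,x)$. Write $x\,\mathrm{op}_z\,y$ if $m=m(x,y,z)$ is a vertex and $I(x,y)=I(x,m)\cup I(m,y)$. The set of OR medians is $\mathfrak M(X)=\{m(x,y,z) : x,y,z\in\partial_{\rm reg}X,\ x\,\mathrm{op}_z\,y\}\subseteq X$. For a vertex $v$ let $(x\cdot y)_v\in\mathbb N\cup\{+\infty\}$ be the number of hyperplanes separating $v$ from $x$ and $y$. Let $\mathscr A(X)\subseteq\overline X^4$ be the set of $(x,y,z,w)$ for which at most one of $(x\cdot y)_v+(z\cdot w)_v$, $(x\cdot z)_v+(y\cdot w)_v$, $(x\cdot w)_v+(y\cdot z)_v$ is infinite, and on it put $\mathrm{cr}(x,y,z,w)=(x\cdot z)_v+(y\cdot w)_v-(x\cdot w)_v-(y\cdot z)_v$; neither depends on $v$. A map $f\colon\mathcal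 A\to\mathcal B$ with $\mathcal A\subseteq\partial X$, $\mathcal B\subseteq\partial Y$ is Möbius if it maps $4$-tuples in $\mathscr A(X)\cap\mathcal A^4$ to $4$-tuples in $\mathscr A(Y)$ and preserves their cross ratio $\mathrm{cr}$. **Theorem.** Let $X,Y$ be locally finite $\mathrm{CAT}(0)$ cube complexes, let $\mathcal A\subseteq\partial_{\rm reg}X$ and $\mathcal B\subseteq\partial_{\rm reg}Y$ be ample, and let $f\colon\mathcal A\to\mathcal B$ be a Möbius bijection. Then there is a unique map $\phi\colon\mathfrak M(X)\to\mathfrak M(Y)$ with $\phi(m(x,y,z))=m(f(x),f(y),f(z))$ for all $x,y,z\in\mathcal A$ with $x\,\mathrm{op}_z\,y$, and the following hold. 1. $\phi$ is a distance-preserving bijection. 2. If $f$ is equivariant with respect to actions by automorphisms of a group $\Gamma$ on $X$ and on $Y$ (so that $\mathcal A$ is $\Gamma$-invariant and $f(gx)=gf(x)$ for all $g\in\Gamma$, $x\in\mathcal A$), then $\mathfrak M(X)$ is $\Gamma$-invariant and $\phi(gv)=g\phi(v)$ for all $g\in\Gamma$, $v\in\mathfrak M(X)$. 3. If vertices $v_n\in\mathfrak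 M(X)$ converge in $\overline X$ to a point $w\in\mathcal A$, then $\phi(v_n)\to f(w)$ in $\overline Y$. 4. If $\Phi\colon X\to Y$ is an isomorphism of cube complexes whose extension to $\overline X$ restricts to $f$ on $\mathcal A$, then $\Phi$ and $\phi$ coincide on $\mathfrak M(X)$. -/

import Mathlib

open Set Filter Topology

/-- A face of the combinatorial cube `{0,1}ⁿ`: the vertices whose coordinates in `S` are
prescribed by `a`. -/
def IsCubeFace {n : ℕ} (F : Set (Fin n → Bool)) : Prop :=
  ∃ (S : Set (Fin n)) (a : Fin n → Bool), F = {x | ∀ i ∈ S, x i = a i}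

/-- A cubical complex with vertex set `V`. Every cube is recorded by its set of vertices. Each cube
is (combinatorially) a copy of some `{0,1}ⁿ`, embedded, whose sub-cubes are exactly its faces, and
two cubes that meet do so in a common face. -/
structure CubicalComplex (V : Type*) where
  cubes : Set (Set V)
  vertex_mem : ∀ v : V, {v} ∈ cubes
  exists_chart : ∀ C ∈ cubes, ∃ (n : ℕ) (p : (Fin n → Bool) → V),
    Function.Injective p ∧ range p = C ∧
      ∀ D : Set V, D ⊆ C → (D ∈ cubes ↔ ∃ F : Set (Fin n → Bool), IsCubeFace F ∧ D = p '' F)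
  inter_mem : ∀ C ∈ cubes, ∀ D ∈ cubes, (C ∩ D).Nonempty → C ∩ D ∈ cubes

namespace CubicalComplex

variable {V : Type*} {W : Type*}

/-- The 1-skeleton. Its path metric is the combinatorial (`ℓ¹`) metric on vertices. -/
def graph (X : CubicalComplex V) : SimpleGraph V where
  Adj u v := u ≠ v ∧ {u, v} ∈ X.cubes
  symm := ⟨fun u v h => ⟨h.1.symm, by rw [Set.pair_comm]; exact h.2⟩⟩
  loopless := ⟨fun _ h => h.1 rfl⟩

/-- `a, b, c, d` are the vertices of a square (a 2-cube), in cyclic order. -/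
def IsSquare (X : CubicalComplex V) (a b c d : V) : Prop :=
  X.graph.Adj a b ∧ X.graph.Adj b c ∧ X.graph.Adj c d ∧ X.graph.Adj d a ∧
    a ≠ c ∧ b ≠ d ∧ ({a, b, c, d} : Set V) ∈ X.cubes

/-- Homotopy of edge paths rel endpoints: generated by removing backtracks and by
pushing a path across a square. -/
inductive Homotopic (X : CubicalComplex V) :
    ∀ {u v : V}, X.graph.Walk u v → X.graph.Walk u v → Prop
  | refl {u v : V} (p : X.graph.Walk u v) : Homotopic X p p
  | symm {u v : V} {p q : X.graph.Walk u v} : Homotopic X p q → Homotopic X q p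
  | trans {u v : V} {p q r : X.graph.Walk u v} :
      Homotopic X p q → Homotopic X q r → Homotopic X p r
  | append {u v w : V} {p p' : X.graph.Walk u v} {q q' : X.graph.Walk v w} :
      Homotopic X p p' → Homotopic X q q' → Homotopic X (p.append q) (p'.append q')
  | backtrack {u v : V} (h : X.graph.Adj u v) :
      Homotopic X (.cons h (.cons h.symm .nil)) (.nil : X.graph.Walk u u)
  | square {a b c d : V} (hab : X.graph.Adj a b) (hbc : X.graph.Adj b c)
      (had : X.graph.Adj a d) (hdc : X.graph.Adj d c) (h : X.IsSquare a b c d) :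
      Homotopic X (.cons hab (.cons hbc .nil)) (.cons had (.cons hdc .nil))

/-- Simple connectedness: connected with trivial edge-path group. -/
def IsSimplyConnected (X : CubicalComplex V) : Prop :=
  X.graph.Connected ∧ ∀ (v : V) (p : X.graph.Walk v v), X.Homotopic p .nil

/-- All links are flag complexes: finitely many edges at `v` that pairwise span squares
are contained in a common cube. -/
def HasFlagLinks (X : CubicalComplex V) : Prop :=
  ∀ (v : V) (S : Finset V), (∀ a ∈ S, X.graph.Adj v a) →
    (∀ a ∈ S, ∀ b ∈ S, a ≠ b → ∃ c, X.IsSquare v a c b) →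
    ∃ C ∈ X.cubes, v ∈ C ∧ (S : Set V) ⊆ C

/-- `CAT(0)` cube complexes, through Gromov's criterion. -/
def IsCAT0 (X : CubicalComplex V) : Prop :=
  X.IsSimplyConnected ∧ X.HasFlagLinks

/-- Every vertex lies on finitely many edges. -/
def LocallyFinite (X : CubicalComplex V) : Prop :=
  ∀ v : V, (X.graph.neighborSet v).Finite

/-- The edges `e` and `f` are opposite sides of a square. -/
def Opposite (X : CubicalComplex V) (e f : Sym2 V) : Prop :=
  ∃ a b c d : V, X.IsSquare a b c d ∧ e = s(a, b) ∧ f = s(d, c)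

/-- A hyperplane, recorded as the set of edges that cross it: a class of the equivalence
relation on edges generated by being opposite in a square. -/
def IsHyperplane (X : CubicalComplex V) (w : Set (Sym2 V)) : Prop :=
  ∃ e ∈ X.graph.edgeSet, w = {f | Relation.EqvGen X.Opposite e f}

/-- `h` is a side of `w`: a connected component of the complement of `w`. -/
def IsSide (X : CubicalComplex V) (w : Set (Sym2 V)) (h : Set V) : Prop :=
  ∃ v : V, h = {u | (X.graph.deleteEdges w).Reachable v u}

/-- Halfspaces, as sets of vertices. -/
def IsHalfspace (X : CubicalComplex V) (h : Set V) : Prop :=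
  ∃ w, X.IsHyperplane w ∧ X.IsSide w h

/-- Transversality of halfspaces: all four intersections are nonempty. -/
def Transverse (h k : Set V) : Prop :=
  (h ∩ k).Nonempty ∧ (hᶜ ∩ k).Nonempty ∧ (h ∩ kᶜ).Nonempty ∧ (hᶜ ∩ kᶜ).Nonempty

/-- Strongly separated halfspaces: disjoint, and no hyperplane is transverse to both. -/
def StronglySeparated (X : CubicalComplex V) (h k : Set V) : Prop :=
  X.IsHalfspace h ∧ X.IsHalfspace k ∧ Disjoint h k ∧
    ∀ j, X.IsHalfspace j → ¬ (Transverse j h ∧ Transverse j k)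

/-- A point of the Roller compactification: an ultrafilter of halfspaces. -/
@[ext]
structure Roller (X : CubicalComplex V) where
  halfspaces : Set (Set V)
  isHalfspace : ∀ h ∈ halfspaces, X.IsHalfspace h
  inter_nonempty : ∀ h ∈ halfspaces, ∀ k ∈ halfspaces, (h ∩ k).Nonempty
  exists_side : ∀ w, X.IsHyperplane w → ∃ h ∈ halfspaces, X.IsSide w h

/-- The topology of pointwise convergence on `2^ℋ`, with `2` discrete. -/
noncomputable instance (X : CubicalComplex V) : TopologicalSpace X.Roller :=
  open Classical in
  TopologicalSpace.induced
    (fun (x : X.Roller) (h : {h : Set V // X.IsHalfspace h}) => decide (h.1 ∈ x.halfspaces))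
    (inferInstance : TopologicalSpace ({h : Set V // X.IsHalfspace h} → Bool))

/-- The embedding of the vertex set into the Roller compactification. -/
def ofVertex (X : CubicalComplex V) (v : V) : X.Roller where
  halfspaces := {h | X.IsHalfspace h ∧ v ∈ h}
  isHalfspace _ h := h.1
  inter_nonempty _ h _ k := ⟨v, h.2, k.2⟩
  exists_side w hw := by
    have hs : X.IsSide w {u | (X.graph.deleteEdges w).Reachable v u} := ⟨v, rfl⟩
    exact ⟨_, ⟨⟨w, hw, hs⟩, SimpleGraph.Reachable.refl v⟩, hs⟩

/-- The Roller boundary. -/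
def boundary (X : CubicalComplex V) : Set X.Roller := (range X.ofVertex)ᶜ

/-- The regular boundary: points `x` of the Roller boundary whose ultrafilter contains a
strongly separated chain. -/
def regularBoundary (X : CubicalComplex V) : Set X.Roller :=
  {x | x ∈ X.boundary ∧ ∃ h : ℕ → Set V, (∀ n, h n ∈ x.halfspaces) ∧
    (∀ n, h (n + 1) ⊂ h n) ∧ ∀ n, X.StronglySeparated (h n)ᶜ (h (n + 1))}

/-- `A` meets the intersection of (the extensions to the Roller compactification of) any finite,
nonempty family of pairwise transverse halfspaces. -/
def Ample (X : CubicalComplex V) (A : Set X.Roller) : Prop :=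
  ∀ S : Finset (Set V), S.Nonempty → (∀ h ∈ S, X.IsHalfspace h) →
    (∀ h ∈ S, ∀ k ∈ S, h ≠ k → Transverse h k) → ∃ x ∈ A, ∀ h ∈ S, h ∈ x.halfspaces

/-- The interval `I(x, y)`: the points that no halfspace separates from both `x` and `y`. -/
def interval (X : CubicalComplex V) (x y : X.Roller) : Set X.Roller :=
  {z | ∀ h, h ∈ x.halfspaces → h ∈ y.halfspaces → h ∈ z.halfspaces}

/-- `m` is the median of `x, y, z`. -/
def IsMedian (X : CubicalComplex V) (x y z m : X.Roller) : Prop :=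
  m ∈ X.interval x y ∧ m ∈ X.interval y z ∧ m ∈ X.interval z x

/-- `x` and `y` are opposite with respect to `z`, with `m(x, y, z)` the vertex `m`. -/
def OppositeAt (X : CubicalComplex V) (x y z : X.Roller) (m : V) : Prop :=
  X.IsMedian x y z (X.ofVertex m) ∧
    X.interval x y = X.interval x (X.ofVertex m) ∪ X.interval (X.ofVertex m) y

/-- The set of OR (opposite regular) medians. -/
def orMedians (X : CubicalComplex V) : Set V :=
  {v | ∃ x ∈ X.regularBoundary, ∃ y ∈ X.regularBoundary, ∃ z ∈ X.regularBoundary,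
    X.OppositeAt x y z v}

/-- The Gromov product `(x · y)_v`: the number of hyperplanes separating `v` from `x` and `y`
(each of them has exactly one side that contains `x` and `y` but not `v`). -/
noncomputable def gromovProduct (X : CubicalComplex V) (v : V) (x y : X.Roller) : ℕ∞ :=
  {h : Set V | h ∈ x.halfspaces ∧ h ∈ y.halfspaces ∧ v ∉ h}.encard

/-- `(x, y, z, w)` lies in the domain of the cross ratio: at most one of the three sums of
Gromov products is infinite. This does not depend on `v`. -/
def CrossRatioDefined (X : CubicalComplex V) (v : V) (x y z w : X.Roller) : Prop :=
  let a := X.gromovProduct v x y + X.gromovProduct v z w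
  let b := X.gromovProduct v x z + X.gromovProduct v y w
  let c := X.gromovProduct v x w + X.gromovProduct v y z
  ¬ (a = ⊤ ∧ b = ⊤) ∧ ¬ (a = ⊤ ∧ c = ⊤) ∧ ¬ (b = ⊤ ∧ c = ⊤)

/-- The cross ratio `(x·z)_v + (y·w)_v - (x·w)_v - (y·z)_v`, meaningful where
`CrossRatioDefined` holds; there it does not depend on `v`. -/
noncomputable def crossRatio (X : CubicalComplex V) (v : V) (x y z w : X.Roller) : EReal :=
  (((X.gromovProduct v x z + X.gromovProduct v y w : ℕ∞) : ENNReal) : EReal) -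
    (((X.gromovProduct v x w + X.gromovProduct v y z : ℕ∞) : ENNReal) : EReal)

/-- Möbius maps. Domain and values of the cross ratios do not depend on the basepoints, so they are
computed from some choice of basepoints. -/
def IsMoebius (X : CubicalComplex V) (Y : CubicalComplex W) {A : Set X.Roller} {B : Set Y.Roller}
    (f : A → B) : Prop :=
  ∃ (v : V) (v' : W), ∀ x y z w : A, X.CrossRatioDefined v x y z w →
    Y.CrossRatioDefined v' (f x) (f y) (f z) (f w) ∧
      Y.crossRatio v' (f x) (f y) (f z) (f w) = X.crossRatio v x y z w

/-- Isomorphisms of cubical complexes. -/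
def IsIso (X : CubicalComplex V) (Y : CubicalComplex W) (Φ : V ≃ W) : Prop :=
  ∀ C : Set V, Φ '' C ∈ Y.cubes ↔ C ∈ X.cubes

section Transport

variable {X : CubicalComplex V} {Y : CubicalComplex W} {Φ : V ≃ W}

theorem IsIso.symm (h : X.IsIso Y Φ) : Y.IsIso X Φ.symm := fun C => by
  rw [← h (Φ.symm '' C), Equiv.image_symm_image]

theorem IsIso.adj (h : X.IsIso Y Φ) {u v : V} (huv : X.graph.Adj u v) :
    Y.graph.Adj (Φ u) (Φ v) :=
  ⟨Φ.injective.ne huv.1, by rw [← Set.image_pair]; exact (h _).2 huv.2⟩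

theorem IsIso.isSquare (h : X.IsIso Y Φ) {a b c d : V} (hs : X.IsSquare a b c d) :
    Y.IsSquare (Φ a) (Φ b) (Φ c) (Φ d) := by
  obtain ⟨h1, h2, h3, h4, h5, h6, h7⟩ := hs
  refine ⟨h.adj h1, h.adj h2, h.adj h3, h.adj h4, Φ.injective.ne h5, Φ.injective.ne h6, ?_⟩
  have := (h _).2 h7
  simpa only [Set.image_insert_eq, Set.image_singleton] using this

theorem IsIso.eqvGen (h : X.IsIso Y Φ) {e f : Sym2 V} (hef : Relation.EqvGen X.Opposite e f) :
    Relation.EqvGen Y.Opposite (e.map Φ) (f.map Φ) := by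
  induction hef with
  | rel e f hr =>
    obtain ⟨a, b, c, d, hs, rfl, rfl⟩ := hr
    exact .rel _ _ ⟨_, _, _, _, h.isSquare hs, rfl, rfl⟩
  | refl e => exact .refl _
  | symm e f _ ih => exact .symm _ _ ih
  | trans e f g _ _ ih1 ih2 => exact .trans _ _ _ ih1 ih2

theorem sym2_map_symm_map (e : Sym2 V) : (e.map Φ).map Φ.symm = e := by
  rw [Sym2.map_map]; simp

theorem IsIso.isHyperplane (h : X.IsIso Y Φ) {w : Set (Sym2 V)} (hw : X.IsHyperplane w) :
    Y.IsHyperplane (Sym2.map Φ '' w) := by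
  obtain ⟨e, he, rfl⟩ := hw
  refine ⟨e.map Φ, ?_, ?_⟩
  · induction e with
    | _ u v => exact h.adj he
  · ext f
    constructor
    · rintro ⟨g, hg, rfl⟩
      exact h.eqvGen hg
    · intro hf
      have := h.symm.eqvGen hf
      rw [sym2_map_symm_map] at this
      refine ⟨f.map Φ.symm, this, ?_⟩
      simpa using sym2_map_symm_map (Φ := Φ.symm) f

theorem IsIso.reachable (h : X.IsIso Y Φ) {w : Set (Sym2 V)} {u v : V}
    (huv : (X.graph.deleteEdges w).Reachable u v) :
    (Y.graph.deleteEdges (Sym2.map Φ '' w)).Reachable (Φ u) (Φ v) := by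
  refine huv.map ⟨Φ, ?_⟩
  intro a b hab
  rw [SimpleGraph.deleteEdges_adj] at hab ⊢
  refine ⟨h.adj hab.1, ?_⟩
  rintro ⟨e, he, heq⟩
  rw [← Sym2.map_mk] at heq
  exact hab.2 (Sym2.map.injective Φ.injective heq ▸ he)

theorem IsIso.isSide (h : X.IsIso Y Φ) {w : Set (Sym2 V)} {k : Set V} (hk : X.IsSide w k) :
    Y.IsSide (Sym2.map Φ '' w) (Φ '' k) := by
  obtain ⟨v, rfl⟩ := hk
  refine ⟨Φ v, ?_⟩
  ext u
  constructor
  · rintro ⟨u, hu, rfl⟩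
    exact h.reachable hu
  · intro hu
    refine ⟨Φ.symm u, ?_, by simp⟩
    have := h.symm.reachable hu
    rw [Set.image_image] at this
    simpa [sym2_map_symm_map] using this

/-- The extension of an isomorphism to the Roller compactifications. -/
def Roller.map (Φ : V ≃ W) (h : X.IsIso Y Φ) (x : X.Roller) : Y.Roller where
  halfspaces := (fun k : Set V => Φ '' k) '' x.halfspaces
  isHalfspace := by
    rintro _ ⟨k, hk, rfl⟩
    obtain ⟨w, hw, hs⟩ := x.isHalfspace k hk
    exact ⟨_, h.isHyperplane hw, h.isSide hs⟩
  inter_nonempty := by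
    rintro _ ⟨k, hk, rfl⟩ _ ⟨l, hl, rfl⟩
    obtain ⟨v, hv, hv'⟩ := x.inter_nonempty k hk l hl
    exact ⟨Φ v, ⟨v, hv, rfl⟩, ⟨v, hv', rfl⟩⟩
  exists_side := by
    intro w hw
    obtain ⟨k, hk, hs⟩ := x.exists_side _ (h.symm.isHyperplane hw)
    refine ⟨Φ '' k, ⟨k, hk, rfl⟩, ?_⟩
    have h1 := h.isSide hs
    rw [Set.image_image] at h1
    simpa [Sym2.map_map] using h1

end Transport

end CubicalComplex

/-!
The theorem is true because Gromov products based at an OR median can be read off from cross ratios.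

*Combinatorics of `CAT(0)` cube complexes.* Edge paths are considered up to pushing them across
squares. Flagness of the links gives a diamond property (`HasFlagLinks.sw_cons_cons`), and so
prolonging reduced paths by edges is a well-defined operation that is compatible with backtracks and
squares (`HasFlagLinks.step_symm`, `HasFlagLinks.step_square`). Homotopic paths therefore act
equally, and simple connectedness makes reduced paths unique up to pushes (`IsCAT0.sw_of_reduced`).
This yields bipartiteness and the quadrangle condition for the 1-skeleton (`IsCAT0.dist_adj`,
`IsCAT0.exists_square`). From these, the halfspaces are the sets of vertices that are nearer to one
endpoint of an edge than to the other, every hyperplane has two complementary sides, distances count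
separating halfspaces (`IsCAT0.encard_separators`), vertices have medians (`IsCAT0.exists_median`),
and halfspaces have the Helly property (`IsCAT0.helly_halfspaces`).

*Opposite triples.* The vertex `v` is the median of `x, y, z` with `x` and `y` opposite if and only
if `(x · z)_v = (y · z)_v = 0` and no halfspace of `x` that avoids `v` meets a halfspace of `y` that
avoids `v` (`IsCAT0.oppositeAt_iff`). In particular `(x · w)_v = 0` or `(y · w)_v = 0` for every
point `w`. Distinct regular points have finite Gromov products, so a Möbius bijection `f` preserves
all cross ratios of points in its domain. If `f x` and `f y` were not opposite at the median of
`f x, f y, f z`, ampleness would provide a point `f w` beyond two transverse halfspaces, one for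
`f x` and one for `f y`, such that no halfspace separates `f w` and `f z` from the median. The cross
ratios of `x, y, z, w` exclude this (`MoebiusEquiv.exists_oppositeAt`).

*The isometry.* For an opposite triple at `v` with image at `v'`, the vanishing Gromov products turn
preserved cross ratios into `(g · w)_v = (f g · f w)_v'` for all `g`, `w`
(`MoebiusEquiv.gromovProduct_eq`). A change of basepoint (`IsCAT0.gromovProduct_add_dist`), applied
to the pairs in three points, shows that Busemann functions are preserved
(`MoebiusEquiv.towards_add_towards`). The distance of two medians is the largest value of a Busemann
function, attained at one of the two opposite points of a triple (`MoebiusEquiv.dist_le`); hence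
distances are preserved, and `v'` depends only on `v`. By `IsCAT0.exists_oppositeAt_of_ample` every
OR median comes from an opposite triple in a given ample set, so this defines the map on all of
them, and `f⁻¹` defines its inverse. Preservation of the Gromov products of medians with boundary
points (`MoebiusEquiv.towards_eq`) gives continuity at regular points, and the
remaining claims follow from the uniqueness of medians.
-/

namespace CubicalComplex

variable {V : Type*} {W : Type*}

/-! ### Squares and cubes -/

section Squares

variable {X : CubicalComplex V} {a b c d e v : V}

theorem IsSquare.rotate (h : X.IsSquare a b c d) : X.IsSquare b c d a := by
  obtain ⟨h1, h2, h3, h4, h5, h6, h7⟩ := h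
  refine ⟨h2, h3, h4, h1, h6, h5.symm, ?_⟩
  have : ({b, c, d, a} : Set V) = {a, b, c, d} := by ext x; simp; tauto
  rwa [this]

theorem IsSquare.reflect (h : X.IsSquare a b c d) : X.IsSquare a d c b := by
  obtain ⟨h1, h2, h3, h4, h5, h6, h7⟩ := h
  refine ⟨h4.symm, h3.symm, h2.symm, h1.symm, h5, h6.symm, ?_⟩
  have : ({a, d, c, b} : Set V) = {a, b, c, d} := by ext x; simp; tauto
  rwa [this]

theorem ncard_of_mem_cubes {C : Set V} (hC : C ∈ X.cubes) : ∃ n : ℕ, C.ncard = 2 ^ n := by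
  obtain ⟨n, p, hp, rfl, -⟩ := X.exists_chart C hC
  refine ⟨n, ?_⟩
  rw [← Set.image_univ, Set.ncard_image_of_injective _ hp, Set.ncard_univ]
  simp

/-- Three consecutive vertices of a square determine it: the intersection of two such squares
would otherwise be a cube with three vertices. -/
theorem IsSquare.unique (h : X.IsSquare a b c d) (h' : X.IsSquare a b c e) : d = e := by
  obtain ⟨h1, h2, h3, h4, h5, h6, h7⟩ := h
  obtain ⟨-, -, h3', h4', -, h6', h7'⟩ := h'
  by_contra hde
  have hD := X.inter_mem _ h7 _ h7' ⟨a, by simp⟩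
  have : ({a, b, c, d} ∩ {a, b, c, e} : Set V) = {a, b, c} := by
    ext x
    simp only [mem_inter_iff, mem_insert_iff, mem_singleton_iff]
    constructor
    · rintro ⟨rfl | rfl | rfl | rfl, h | h | h | h⟩ <;> simp_all
    · tauto
  rw [this] at hD
  obtain ⟨n, hn⟩ := ncard_of_mem_cubes hD
  have h3 : ({a, b, c} : Set V).ncard = 3 := by
    rw [Set.ncard_eq_three]
    exact ⟨a, b, c, h1.ne, h5, h2.ne, rfl⟩
  rw [h3] at hn
  rcases n with _ | _ | n
  · omega
  · omega
  · have := Nat.one_le_two_pow (n := n)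
    rw [pow_succ, pow_succ] at hn
    omega

theorem IsSquare.unique_opposite (h : X.IsSquare a b c d) (h' : X.IsSquare a b e d) : c = e :=
  h.rotate.rotate.rotate.unique h'.rotate.rotate.rotate

/-- The vertex of the combinatorial cube obtained from `x` by changing its `i`-th coordinate. -/
def flip {n : ℕ} (i : Fin n) (x : Fin n → Bool) : Fin n → Bool := Function.update x i (!x i)

theorem flip_comm {n : ℕ} (i j : Fin n) (x : Fin n → Bool) :
    flip i (flip j x) = flip j (flip i x) := by
  by_cases h : i = j
  · rw [h]
  · funext t
    simp only [flip, Function.update_apply]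
    grind

theorem flip_ne {n : ℕ} (i : Fin n) (x : Fin n → Bool) : flip i x ≠ x := by
  intro h
  have := congrFun h i
  simp [flip] at this

theorem flip_injective_left {n : ℕ} {i j : Fin n} {x : Fin n → Bool}
    (h : flip i x = flip j x) : i = j := by
  by_contra hij
  have := congrFun h i
  simp [flip, hij] at this

theorem flip_flip_ne {n : ℕ} {i j : Fin n} (hij : i ≠ j) (x : Fin n → Bool) :
    flip j (flip i x) ≠ x := by
  intro h
  have := congrFun h i
  simp [flip, Function.update_apply, hij] at this

variable {n : ℕ} {p : (Fin n → Bool) → V} {C : Set V}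

theorem adj_flip (hp : Function.Injective p) (hr : range p = C)
    (hC : ∀ D : Set V, D ⊆ C → (D ∈ X.cubes ↔ ∃ F : Set (Fin n → Bool), IsCubeFace F ∧ D = p '' F))
    (i : Fin n) (x : Fin n → Bool) : X.graph.Adj (p x) (p (flip i x)) := by
  refine ⟨hp.ne (flip_ne i x).symm, (hC _ ?_).2 ⟨{y | ∀ t ∈ ({i}ᶜ : Set (Fin n)), y t = x t},
    ⟨_, _, rfl⟩, ?_⟩⟩
  · rw [← hr]
    rintro _ (rfl | rfl) <;> exact mem_range_self _
  · rw [← Set.image_pair]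
    congr 1
    ext y
    simp only [mem_insert_iff, mem_singleton_iff, mem_ofPred_eq, mem_compl_iff]
    constructor
    · rintro (rfl | rfl) t ht
      · rfl
      · simp [flip, ht]
    · intro h
      by_cases hy : y i = x i
      · left
        funext t
        by_cases ht : t = i
        · rw [ht, hy]
        · exact h t ht
      · right
        funext t
        by_cases ht : t = i
        · subst ht
          simp only [flip, Function.update_self]
          revert hy
          cases y t <;> cases x t <;> simp
        · simp [flip, ht, h t ht]

theorem isSquare_flip (hp : Function.Injective p) (hr : range p = C)
    (hC : ∀ D : Set V, D ⊆ C → (D ∈ X.cubes ↔ ∃ F : Set (Fin n → Bool), IsCubeFace F ∧ D = p '' F))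
    {i j : Fin n} (hij : i ≠ j) (x : Fin n → Bool) :
    X.IsSquare (p x) (p (flip i x)) (p (flip j (flip i x))) (p (flip j x)) := by
  refine ⟨adj_flip hp hr hC _ _, adj_flip hp hr hC _ _, ?_, (adj_flip hp hr hC _ _).symm,
    hp.ne (flip_flip_ne hij x).symm, hp.ne fun h => hij (flip_injective_left h), ?_⟩
  · rw [flip_comm]
    exact (adj_flip hp hr hC _ _).symm
  refine (hC _ ?_).2 ⟨{y | ∀ t ∈ ({i, j}ᶜ : Set (Fin n)), y t = x t}, ⟨_, _, rfl⟩, ?_⟩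
  · rw [← hr]
    rintro _ (rfl | rfl | rfl | rfl) <;> exact mem_range_self _
  · have : ({p x, p (flip i x), p (flip j (flip i x)), p (flip j x)} : Set V) =
      p '' {x, flip i x, flip j (flip i x), flip j x} := by
      simp only [Set.image_insert_eq, Set.image_singleton]
    rw [this]
    congr 1
    ext y
    simp only [mem_insert_iff, mem_singleton_iff, mem_ofPred_eq, mem_compl_iff]
    constructor
    · rintro (rfl | rfl | rfl | rfl) t ht <;> push Not at ht <;>
        simp [flip, Function.update_apply, ht]
    · intro h
      simp only [funext_iff, flip, Function.update_apply]
      have key : ∀ z : Fin n → Bool, (z i = y i) → z j = y j → (∀ t, t ≠ i → t ≠ j → z t = x t) →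
          ∀ t, y t = z t := by
        intro z h1 h2 h3 t
        by_cases hti : t = i
        · rw [hti, h1]
        · by_cases htj : t = j
          · rw [htj, h2]
          · rw [h3 t hti htj, h t (by tauto)]
      cases hyi : y i <;> cases hyj : y j <;> cases hxi : x i <;> cases hxj : x j <;>
      first
      | (refine .inl (key _ ?_ ?_ ?_) <;> grind)
      | (refine .inr (.inl (key _ ?_ ?_ ?_)) <;> grind)
      | (refine .inr (.inr (.inl (key _ ?_ ?_ ?_))) <;> grind)
      | (refine .inr (.inr (.inr (key _ ?_ ?_ ?_))) <;> grind)

theorem exists_flip_of_adj (hp : Function.Injective p) (hr : range p = C)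
    (hC : ∀ D : Set V, D ⊆ C → (D ∈ X.cubes ↔ ∃ F : Set (Fin n → Bool), IsCubeFace F ∧ D = p '' F))
    {x : Fin n → Bool} (ha : a ∈ C) (h : X.graph.Adj (p x) a) : ∃ i, a = p (flip i x) := by
  rw [← hr] at ha
  obtain ⟨y, rfl⟩ := ha
  have hsub : ({p x, p y} : Set V) ⊆ C := by
    rw [← hr]; rintro _ (rfl | rfl) <;> exact mem_range_self _
  obtain ⟨F, ⟨S, t, rfl⟩, hF⟩ := (hC _ hsub).1 h.2
  rw [← Set.image_pair] at hF
  have hF' := hp.image_injective hF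
  have hx : x ∈ {z : Fin n → Bool | ∀ i ∈ S, z i = t i} := by rw [← hF']; simp
  have hy : y ∈ {z : Fin n → Bool | ∀ i ∈ S, z i = t i} := by rw [← hF']; simp
  have hxy : x ≠ y := fun hxy => h.1 (by rw [hxy])
  obtain ⟨i, hi⟩ : ∃ i, x i ≠ y i := by
    by_contra hcon
    push Not at hcon
    exact hxy (funext hcon)
  have hiS : i ∉ S := fun hiS => hi ((hx i hiS).trans (hy i hiS).symm)
  have hfl : flip i x ∈ ({x, y} : Set (Fin n → Bool)) := by
    rw [hF']
    intro j hj
    have : j ≠ i := fun hji => hiS (hji ▸ hj)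
    simp [flip, this, hx j hj]
  rcases hfl with h1 | h1
  · exact absurd h1 (flip_ne i x)
  · exact ⟨i, by rw [h1]⟩

/-- Three squares around a vertex that pairwise share an edge are three faces of a 3-cube; `e` is
its vertex opposite to `v`. -/
theorem HasFlagLinks.exists_cube (hX : X.HasFlagLinks) {ab bc ac : V} (h1 : X.IsSquare v a ab b)
    (h2 : X.IsSquare v b bc c) (h3 : X.IsSquare v a ac c) :
    ∃ e, X.IsSquare a ab e ac ∧ X.IsSquare b ab e bc ∧ X.IsSquare c ac e bc := by
  classical
  obtain ⟨C, hC, hv, hS⟩ := hX v {a, b, c}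
    (by
      simp only [Finset.mem_insert, Finset.mem_singleton]
      rintro x (rfl | rfl | rfl)
      exacts [h1.1, h2.1, h2.2.2.2.1.symm])
    (by
      simp only [Finset.mem_insert, Finset.mem_singleton]
      rintro x (rfl | rfl | rfl) y (rfl | rfl | rfl) hxy
      exacts [absurd rfl hxy, ⟨_, h1⟩, ⟨_, h3⟩, ⟨_, h1.reflect⟩, absurd rfl hxy, ⟨_, h2⟩,
        ⟨_, h3.reflect⟩, ⟨_, h2.reflect⟩, absurd rfl hxy])
  obtain ⟨n, p, hp, hr, hD⟩ := X.exists_chart C hC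
  obtain ⟨x, rfl⟩ : v ∈ range p := hr ▸ hv
  obtain ⟨i, rfl⟩ := exists_flip_of_adj hp hr hD (hS (by simp)) h1.1
  obtain ⟨j, rfl⟩ := exists_flip_of_adj hp hr hD (hS (by simp)) h2.1
  obtain ⟨k, rfl⟩ := exists_flip_of_adj hp hr hD (hS (by simp)) h2.2.2.2.1.symm
  have hij : i ≠ j := fun h => h1.2.2.2.2.2.1 (by rw [h])
  have hik : i ≠ k := fun h => h3.2.2.2.2.2.1 (by rw [h])
  have hjk : j ≠ k := fun h => h2.2.2.2.2.2.1 (by rw [h])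
  obtain rfl : ab = p (flip j (flip i x)) := h1.unique_opposite (isSquare_flip hp hr hD hij x)
  obtain rfl : bc = p (flip k (flip j x)) := h2.unique_opposite (isSquare_flip hp hr hD hjk x)
  obtain rfl : ac = p (flip k (flip i x)) := h3.unique_opposite (isSquare_flip hp hr hD hik x)
  refine ⟨p (flip k (flip j (flip i x))), isSquare_flip hp hr hD hjk _, ?_, ?_⟩
  · have := isSquare_flip hp hr hD hik (flip j x)
    rwa [flip_comm i j] at this
  · have := isSquare_flip hp hr hD hij (flip k x)
    rwa [flip_comm i k, flip_comm j k, flip_comm j k] at this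

end Squares

/-! ### Edge paths up to pushing across squares -/

section Paths

variable {X : CubicalComplex V}

/-- Two edge paths are related if they differ by finitely many pushes across squares. A path is
recorded as the list of its vertices in reverse order, so that the head is the current endpoint. -/
inductive Sw (X : CubicalComplex V) : List V → List V → Prop
  | refl (p : List V) : Sw X p p
  | trans {p q r : List V} : Sw X p q → Sw X q r → Sw X p r
  | cons (u : V) {p q : List V} : Sw X p q → Sw X (u :: p) (u :: q)
  | square {a b c d : V} (h : X.IsSquare a b c d) (l : List V) :
      Sw X (c :: b :: a :: l) (c :: d :: a :: l)

theorem Sw.symm {p q : List V} (h : X.Sw p q) : X.Sw q p := by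
  induction h with
  | refl p => exact .refl p
  | trans _ _ ih1 ih2 => exact ih2.trans ih1
  | cons u _ ih => exact ih.cons u
  | square h l => exact .square h.reflect l

theorem Sw.length_eq {p q : List V} (h : X.Sw p q) : p.length = q.length := by
  induction h with
  | refl p => rfl
  | trans _ _ ih1 ih2 => exact ih1.trans ih2
  | cons u _ ih => simp [ih]
  | square h l => simp

theorem Sw.head?_eq {p q : List V} (h : X.Sw p q) : p.head? = q.head? := by
  induction h with
  | refl p => rfl
  | trans _ _ ih1 ih2 => exact ih1.trans ih2
  | cons u _ ih => simp
  | square h l => simp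

/-- The diamond property of pushes: if two equivalent paths end with the edges `a → u` and
`b → u`, then either these edges and the remaining paths agree, or the edges are adjacent sides
of a square `c a u b`, and both remaining paths can be routed through `c`. -/
theorem HasFlagLinks.sw_cons_cons (hX : X.HasFlagLinks) {p q : List V} (h : X.Sw p q) {u a : V}
    {l : List V} (hp : p = u :: a :: l) :
    ∃ b l', q = u :: b :: l' ∧ ((a = b ∧ X.Sw (a :: l) (b :: l')) ∨
      ∃ c m, X.IsSquare c a u b ∧ X.Sw (a :: l) (a :: c :: m) ∧ X.Sw (b :: l') (b :: c :: m)) := by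
  induction hn : p.length using Nat.strong_induction_on generalizing p q u a l with
  | _ n IH =>
    subst hn
    induction h generalizing u a l with
    | refl p => exact ⟨a, l, hp, .inl ⟨rfl, .refl _⟩⟩
    | @cons x p q h _ =>
      obtain ⟨rfl, rfl⟩ := List.cons.inj hp
      have hh := h.head?_eq
      match q, hh with
      | b :: l', hh =>
        simp only [List.head?_cons, Option.some.injEq] at hh
        subst hh
        exact ⟨a, l', rfl, .inl ⟨rfl, h⟩⟩
    | @square a' b c d h l' =>
      simp only [List.cons.injEq] at hp
      obtain ⟨rfl, rfl, rfl⟩ := hp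
      exact ⟨_, _, rfl, .inr ⟨_, _, h, .refl _, .refl _⟩⟩
    | @trans p r q h1 h2 ih1 ih2 =>
      obtain ⟨b, l1, rfl, hab⟩ := ih1 hp IH
      obtain ⟨d, l2, rfl, hbd⟩ := ih2 rfl (by rw [← h1.length_eq]; exact IH)
      refine ⟨d, l2, rfl, ?_⟩
      have hlen := h1.length_eq
      rcases hab with ⟨rfl, hab⟩ | ⟨c0, m0, hs0, ha0, hb0⟩
      · rcases hbd with ⟨rfl, hbd⟩ | ⟨c1, m1, hs1, hb1, hd1⟩
        · exact .inl ⟨rfl, hab.trans hbd⟩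
        · exact .inr ⟨c1, m1, hs1, hab.trans hb1, hd1⟩
      · rcases hbd with ⟨rfl, hbd⟩ | ⟨c1, m1, hs1, hb1, hd1⟩
        · exact .inr ⟨c0, m0, hs0, ha0, hbd.symm.trans hb0⟩
        · -- both squares contain the edge `b u`, and the diamond property applies to the
          -- shorter paths to `b`
          obtain ⟨_, _, heq, h⟩ := IH _ (by
            have := ha0.length_eq
            have := hb0.length_eq
            simp only [List.length_cons, hp] at *
            omega) (hb0.symm.trans hb1) rfl rfl
          simp only [List.cons.injEq, true_and] at heq
          obtain ⟨rfl, rfl⟩ := heq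
          rcases h with ⟨rfl, h⟩ | ⟨e, m2, hs2, hc0, hc1⟩
          · obtain rfl : a = d := hs0.reflect.unique hs1
            exact .inl ⟨rfl, ha0.trans ((h.cons a).trans hd1.symm)⟩
          · obtain ⟨f, hf1, hf2, hf3⟩ := hX.exists_cube hs0.rotate.rotate.rotate.reflect
              hs2.rotate.rotate.reflect hs1.rotate
            exact .inr ⟨f, e :: m2, hf1.rotate.rotate.reflect,
              ha0.trans ((hc0.cons a).trans (.square hf2.rotate.rotate.rotate m2)),
              hd1.trans ((hc1.cons d).trans (.square hf3.rotate.rotate.rotate m2))⟩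

/-- The path runs back along an edge immediately after crossing it. -/
inductive HasBacktrack : List V → Prop
  | head (a b : V) (l : List V) : HasBacktrack (a :: b :: a :: l)
  | cons (u : V) {l : List V} : HasBacktrack l → HasBacktrack (u :: l)

/-- No sequence of pushes across squares creates a backtrack. -/
def Reduced (X : CubicalComplex V) (p : List V) : Prop :=
  ∀ q, X.Sw p q → ¬ HasBacktrack q

theorem Reduced.sw {p q : List V} (hp : X.Reduced p) (h : X.Sw p q) : X.Reduced q :=
  fun r hr => hp r (h.trans hr)

theorem Reduced.tail {u : V} {p : List V} (hp : X.Reduced (u :: p)) : X.Reduced p :=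
  fun _ hr hb => hp _ (hr.cons u) (hb.cons u)

theorem Sw.singleton_iff {v : V} {q : List V} : X.Sw [v] q ↔ q = [v] := by
  constructor
  · intro h
    have h1 := h.length_eq
    have h2 := h.head?_eq
    match q, h1, h2 with
    | [w], _, h2 => simpa using h2.symm
  · rintro rfl
    exact .refl _

theorem reduced_singleton (v : V) : X.Reduced [v] := by
  intro q hq
  rw [Sw.singleton_iff] at hq
  subst hq
  rintro (_ | ⟨_, h⟩)
  cases h

/-- If appending an edge to a reduced path destroys reducedness, then the path can be pushed to one
that ends with the same edge. -/
theorem HasFlagLinks.sw_of_not_reduced (hX : X.HasFlagLinks) {u v : V} {l : List V}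
    (hu : X.Reduced (u :: l)) (hv : ¬ X.Reduced (v :: u :: l)) :
    ∃ m, X.Sw (u :: l) (u :: v :: m) := by
  induction hn : l.length using Nat.strong_induction_on generalizing u v l with
  | _ n IH =>
    subst hn
    simp only [Reduced, not_forall, not_not] at hv
    obtain ⟨s, hs, hb⟩ := hv
    obtain ⟨b, s', rfl, h⟩ := hX.sw_cons_cons hs rfl
    have hb' : (∃ t, s' = v :: t) ∨ HasBacktrack (b :: s') := by
      cases hb with
      | head _ _ t => exact .inl ⟨t, rfl⟩
      | cons _ h => exact .inr h
    rcases h with ⟨rfl, h⟩ | ⟨c, m, hsq, h1, h2⟩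
    · rcases hb' with ⟨t, rfl⟩ | hb'
      · exact ⟨t, h⟩
      · exact absurd hb' (hu _ h)
    · rcases hb' with ⟨t, rfl⟩ | hb'
      · obtain ⟨c', m', heq, h⟩ := hX.sw_cons_cons h2 rfl
        simp only [List.cons.injEq, true_and] at heq
        obtain ⟨rfl, rfl⟩ := heq
        rcases h with ⟨rfl, h⟩ | ⟨d, m2, hsq2, h3, h4⟩
        · exact absurd rfl hsq.2.2.2.2.1
        · -- the two squares share the corner at `b`, so that `d = u` and there is a backtrack
          obtain rfl : u = d := hsq.reflect.unique hsq2.reflect.rotate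
          exact absurd (.head _ _ _) (hu _ (h1.trans (h4.cons _)))
      · have hcm : X.Reduced (c :: m) := (hu.sw h1).tail
        have hl := h1.length_eq
        simp only [List.length_cons] at hl
        obtain ⟨m', hm'⟩ := IH m.length (by omega) hcm
          (fun hr => hr _ h2.symm hb') rfl
        exact ⟨b :: m', h1.trans ((hm'.cons u).trans (.square hsq.rotate.rotate.rotate _))⟩

/-- Prolonging the class of the reduced path `p`, which ends at `u`, by the edge from `u` to `v`
gives the class of the reduced path `q`. -/
def Step (X : CubicalComplex V) (u v : V) (p q : List V) : Prop :=
  X.Reduced p ∧ p.head? = some u ∧ ((∃ l, X.Sw p (u :: v :: l) ∧ X.Sw q (v :: l)) ∨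
    ((¬ ∃ l, X.Sw p (u :: v :: l)) ∧ X.Sw q (v :: p)))

theorem Step.sw {u v : V} {p q p' q' : List V} (h : X.Step u v p q) (hp : X.Sw p p')
    (hq : X.Sw q q') : X.Step u v p' q' := by
  obtain ⟨h1, h2, h⟩ := h
  refine ⟨h1.sw hp, hp.head?_eq ▸ h2, ?_⟩
  rcases h with ⟨l, h3, h4⟩ | ⟨h3, h4⟩
  · exact .inl ⟨l, hp.symm.trans h3, hq.symm.trans h4⟩
  · exact .inr ⟨fun ⟨l, hl⟩ => h3 ⟨l, hp.trans hl⟩, hq.symm.trans (h4.trans (hp.cons v))⟩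

theorem HasFlagLinks.step_good (hX : X.HasFlagLinks) {u v : V} {p q : List V}
    (h : X.Step u v p q) : X.Reduced q ∧ q.head? = some v := by
  obtain ⟨h1, h2, ⟨l, h3, h4⟩ | ⟨h3, h4⟩⟩ := h
  · exact ⟨(h1.sw h3).tail.sw h4.symm, by rw [h4.head?_eq]; rfl⟩
  · refine ⟨?_, by rw [h4.head?_eq]; rfl⟩
    by_contra hr
    match p, h2 with
    | w :: p, h2 =>
      obtain rfl : w = u := by simpa using h2
      exact h3 (hX.sw_of_not_reduced h1 fun hr' => hr (hr'.sw h4.symm))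

theorem exists_step {u : V} (v : V) {p : List V} (h : X.Reduced p) (h' : p.head? = some u) :
    ∃ q, X.Step u v p q := by
  by_cases hl : ∃ l, X.Sw p (u :: v :: l)
  · exact ⟨v :: hl.choose, h, h', .inl ⟨_, hl.choose_spec, .refl _⟩⟩
  · exact ⟨v :: p, h, h', .inr ⟨hl, .refl _⟩⟩

theorem HasFlagLinks.sw_cancel (hX : X.HasFlagLinks) {u v : V} {l l' : List V}
    (h : X.Sw (u :: v :: l) (u :: v :: l')) : X.Sw (v :: l) (v :: l') := by
  obtain ⟨_, _, heq, h⟩ := hX.sw_cons_cons h rfl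
  simp only [List.cons.injEq, true_and] at heq
  obtain ⟨rfl, rfl⟩ := heq
  rcases h with ⟨-, h⟩ | ⟨c, m, hs, -, -⟩
  · exact h
  · exact absurd rfl hs.2.2.2.2.2.1

theorem HasFlagLinks.step_unique (hX : X.HasFlagLinks) {u v : V} {p q q' : List V}
    (h : X.Step u v p q) (h' : X.Step u v p q') : X.Sw q q' := by
  obtain ⟨-, -, ⟨l, h3, h4⟩ | ⟨h3, h4⟩⟩ := h <;>
    obtain ⟨-, -, ⟨l', h3', h4'⟩ | ⟨h3', h4'⟩⟩ := h'
  · exact h4.trans ((hX.sw_cancel (h3.symm.trans h3')).trans h4'.symm)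
  · exact absurd ⟨l, h3⟩ h3'
  · exact absurd ⟨l', h3'⟩ h3
  · exact h4.trans h4'.symm

theorem HasFlagLinks.step_symm (hX : X.HasFlagLinks) {u v : V} {p q : List V}
    (h : X.Step u v p q) : X.Step v u q p := by
  refine ⟨(hX.step_good h).1, (hX.step_good h).2, ?_⟩
  obtain ⟨h1, h2, ⟨l, h3, h4⟩ | ⟨h3, h4⟩⟩ := h
  · refine .inr ⟨?_, h3.trans (h4.symm.cons u)⟩
    rintro ⟨l', h5⟩
    exact h1 _ (h3.trans ((h4.symm.trans h5).cons u)) (.head _ _ _)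
  · match p, h2 with
    | w :: p, h2 =>
      obtain rfl : w = u := by simpa using h2
      exact .inl ⟨p, h4, .refl _⟩

/-- The two ways around a square act equally on classes of reduced paths. -/
theorem HasFlagLinks.step_square (hX : X.HasFlagLinks) {a b c d : V} (hs : X.IsSquare a b c d)
    {p q q' r : List V} (hab : X.Step a b p q) (hbc : X.Step b c q r) (had : X.Step a d p q') :
    X.Step d c q' r := by
  have hq := hX.step_good hab
  have hq' := hX.step_good had
  obtain ⟨h1, h2, ⟨l, h3, h4⟩ | ⟨h3, h4⟩⟩ := hab <;>
    obtain ⟨-, -, ⟨l', h3', h4'⟩ | ⟨h3', h4'⟩⟩ := had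
  · obtain ⟨_, _, heq, h⟩ := hX.sw_cons_cons (h3.symm.trans h3') rfl
    simp only [List.cons.injEq, true_and] at heq
    obtain ⟨rfl, rfl⟩ := heq
    rcases h with ⟨rfl, h⟩ | ⟨e, m, hs', h5, h6⟩
    · exact absurd rfl hs.2.2.2.2.2.1
    · obtain rfl : c = e := hs.rotate.rotate.rotate.unique hs'.reflect.rotate
      have hr := hX.step_unique hbc ⟨hq.1, hq.2, .inl ⟨m, h4.trans h5, .refl _⟩⟩
      exact ⟨hq'.1, hq'.2, .inl ⟨m, h4'.trans h6, hr⟩⟩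
  · have hr := hX.step_unique hbc ⟨hq.1, hq.2, .inr ⟨?_, .refl _⟩⟩
    · refine ⟨hq'.1, hq'.2, .inl ⟨b :: l, h4'.trans ((h3.cons d).trans ?_), hr.trans (h4.cons c)⟩⟩
      exact .square hs.reflect.rotate.rotate.rotate l
    · rintro ⟨l', hl'⟩
      exact h3' ⟨c :: l', h3.trans (((h4.symm.trans hl').cons a).trans
        (.square hs.reflect.rotate.rotate l'))⟩
  · have hr := hX.step_unique hbc ⟨hq.1, hq.2, .inl ⟨d :: l', h4.trans ((h3'.cons b).trans
      (.square hs.rotate.rotate.rotate l')), .refl _⟩⟩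
    refine ⟨hq'.1, hq'.2, .inr ⟨?_, hr.trans (h4'.symm.cons c)⟩⟩
    rintro ⟨m, hm⟩
    exact h3 ⟨c :: m, h3'.trans (((h4'.symm.trans hm).cons a).trans
      (.square hs.rotate.rotate m))⟩
  · match p, h2 with
    | w :: p, h2 =>
      obtain rfl : w = a := by simpa using h2
      -- neither `q` nor `q'` can be pushed to a path through `c`
      have key : ∀ {x y : V} {s : List V}, X.IsSquare w x c y →
          (¬ ∃ l, X.Sw (w :: p) (w :: y :: l)) → X.Sw s (x :: w :: p) →
          ¬ ∃ l, X.Sw s (x :: c :: l) := by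
        rintro x y s hs hy hs' ⟨l, hl⟩
        obtain ⟨_, _, heq, h⟩ := hX.sw_cons_cons (hs'.symm.trans hl) rfl
        simp only [List.cons.injEq, true_and] at heq
        obtain ⟨rfl, rfl⟩ := heq
        rcases h with ⟨rfl, h⟩ | ⟨e, m, hs', h5, h6⟩
        · exact absurd rfl hs.2.2.2.2.1
        · obtain rfl : y = e := hs.unique hs'.rotate
          exact hy ⟨m, h5⟩
      have hr := hX.step_unique hbc ⟨hq.1, hq.2, .inr ⟨key hs h3' h4, .refl _⟩⟩
      exact ⟨hq'.1, hq'.2, .inr ⟨key hs.reflect h3 h4', hr.trans ((h4.cons c).trans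
        ((Sw.square hs p).trans (h4'.symm.cons c)))⟩⟩

/-- The action of edge paths on classes of reduced paths by prolongation. -/
def Act (X : CubicalComplex V) : ∀ {u v : V}, X.graph.Walk u v → List V → List V → Prop
  | u, _, .nil, p, q => X.Reduced p ∧ p.head? = some u ∧ X.Sw p q
  | u, _, .cons (v := v) _ w, p, q => ∃ r, X.Step u v p r ∧ Act X w r q

theorem Act.good {u v : V} {w : X.graph.Walk u v} {p q : List V} (h : X.Act w p q) :
    X.Reduced p ∧ p.head? = some u := by
  cases w with
  | nil => exact ⟨h.1, h.2.1⟩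
  | cons hw w => obtain ⟨r, hr, -⟩ := h; exact ⟨hr.1, hr.2.1⟩

theorem Act.sw {u v : V} {w : X.graph.Walk u v} {p q p' q' : List V} (h : X.Act w p q)
    (hp : X.Sw p p') (hq : X.Sw q q') : X.Act w p' q' := by
  induction w generalizing p p' with
  | nil => exact ⟨h.1.sw hp, hp.head?_eq ▸ h.2.1, hp.symm.trans (h.2.2.trans hq)⟩
  | cons hw w ih =>
    obtain ⟨r, hr, h⟩ := h
    exact ⟨r, hr.sw hp (.refl _), ih h (.refl _)⟩

theorem HasFlagLinks.act_unique (hX : X.HasFlagLinks) {u v : V} {w : X.graph.Walk u v}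
    {p q q' : List V} (h : X.Act w p q) (h' : X.Act w p q') : X.Sw q q' := by
  induction w generalizing p with
  | nil => exact h.2.2.symm.trans h'.2.2
  | cons hw w ih =>
    obtain ⟨r, hr, h⟩ := h
    obtain ⟨r', hr', h'⟩ := h'
    exact ih h (h'.sw (hX.step_unique hr' hr) (.refl _))

theorem act_append {u v w : V} (P : X.graph.Walk u v) (Q : X.graph.Walk v w) {p q : List V} :
    X.Act (P.append Q) p q ↔ ∃ r, X.Act P p r ∧ X.Act Q r q := by
  induction P generalizing p with
  | nil =>
    constructor
    · intro h
      exact ⟨p, ⟨h.good.1, h.good.2, .refl _⟩, h⟩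
    · rintro ⟨r, hr, h⟩
      exact h.sw hr.2.2.symm (.refl _)
  | cons hP P ih =>
    constructor
    · rintro ⟨r, hr, h⟩
      obtain ⟨s, hs, h⟩ := (ih Q).1 h
      exact ⟨s, ⟨r, hr, hs⟩, h⟩
    · rintro ⟨r, ⟨s, hs, hr⟩, h⟩
      exact ⟨s, hs, (ih Q).2 ⟨r, hr, h⟩⟩

theorem HasFlagLinks.act_square (hX : X.HasFlagLinks) {a b c d : V} (hab : X.graph.Adj a b)
    (hbc : X.graph.Adj b c) (had : X.graph.Adj a d) (hdc : X.graph.Adj d c)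
    (h : X.IsSquare a b c d) {p q : List V}
    (hact : X.Act (.cons hab (.cons hbc .nil) : X.graph.Walk a c) p q) :
    X.Act (.cons had (.cons hdc .nil) : X.graph.Walk a c) p q := by
  obtain ⟨r, hr, s, hs, h1, h2, h3⟩ := hact
  obtain ⟨r', hr'⟩ := exists_step d hr.1 hr.2.1
  exact ⟨r', hr', s, hX.step_square h hr hs hr', h1, h2, h3⟩

theorem HasFlagLinks.act_congr (hX : X.HasFlagLinks) {u v : V} {P Q : X.graph.Walk u v}
    (h : X.Homotopic P Q) {p q : List V} : X.Act P p q ↔ X.Act Q p q := by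
  induction h generalizing p q with
  | refl => rfl
  | symm _ ih => exact ih.symm
  | trans _ _ ih1 ih2 => exact ih1.trans ih2
  | append _ _ ih1 ih2 => simp only [act_append, ih1, ih2]
  | @backtrack u v hadj =>
    constructor
    · rintro ⟨r, hr, s, hs, h1, h2, h3⟩
      exact ⟨hr.1, hr.2.1, (hX.step_unique (hX.step_symm hr) hs).trans h3⟩
    · rintro ⟨h1, h2, h3⟩
      obtain ⟨r, hr⟩ := exists_step v h1 h2
      exact ⟨r, hr, p, hX.step_symm hr, h1, h2, h3⟩
  | square hab hbc had hdc h =>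
    exact ⟨hX.act_square hab hbc had hdc h, hX.act_square had hdc hab hbc h.reflect⟩

theorem HasFlagLinks.act_reverse (hX : X.HasFlagLinks) {u v : V} {P : X.graph.Walk u v}
    {p q : List V} (h : X.Act P p q) : X.Act P.reverse q p := by
  induction P generalizing p with
  | nil => exact ⟨h.1.sw h.2.2, h.2.2.head?_eq ▸ h.2.1, h.2.2.symm⟩
  | cons hadj P ih =>
    obtain ⟨r, hr, h⟩ := h
    rw [SimpleGraph.Walk.reverse_cons, act_append]
    exact ⟨r, ih h, p, hX.step_symm hr, hr.1, hr.2.1, .refl _⟩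

/-- `p` is the reversed list of vertices of an edge path that starts at `v`. -/
inductive PathFrom (X : CubicalComplex V) (v : V) : List V → Prop
  | single : PathFrom X v [v]
  | cons {a b : V} {l : List V} : PathFrom X v (a :: l) → X.graph.Adj a b →
      PathFrom X v (b :: a :: l)

theorem PathFrom.adj {v a b : V} {l : List V} (h : X.PathFrom v (b :: a :: l)) :
    X.graph.Adj a b := by
  cases h; assumption

theorem PathFrom.tail {v a b : V} {l : List V} (h : X.PathFrom v (b :: a :: l)) :
    X.PathFrom v (a :: l) := by
  cases h; assumption

theorem PathFrom.sw {v : V} {p q : List V} (h : X.Sw p q) (hp : X.PathFrom v p) :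
    X.PathFrom v q := by
  induction h with
  | refl => exact hp
  | trans _ _ ih1 ih2 => exact ih2 (ih1 hp)
  | @cons u p q h ih =>
    have hh := h.head?_eq
    match p, q, hh with
    | [], [], _ => exact hp
    | a :: p, b :: q, hh =>
      obtain rfl : a = b := by simpa using hh
      exact .cons (ih hp.tail) hp.adj
  | square h l => exact .cons (.cons hp.tail.tail h.2.2.2.1.symm) h.2.2.1.symm

/-- In a simply connected complex with flag links, reduced paths with the same endpoints differ by
pushes across squares: both are what every path between the endpoints makes out of the constant
path. -/
theorem IsCAT0.sw_of_reduced (hX : X.IsCAT0) {v u : V} {l l' : List V}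
    (h : X.PathFrom v (u :: l)) (h' : X.PathFrom v (u :: l')) (hr : X.Reduced (u :: l))
    (hr' : X.Reduced (u :: l')) : X.Sw (u :: l) (u :: l') := by
  have key : ∀ {p : List V}, X.PathFrom v p → X.Reduced p → ∃ u, p.head? = some u ∧
      ∃ P : X.graph.Walk v u, X.Act P [v] p := by
    intro p hp
    induction hp with
    | single => exact fun hr => ⟨v, rfl, .nil, hr, rfl, .refl _⟩
    | @cons a b l hp hadj ih =>
      intro hr
      obtain ⟨u, hu, P, hP⟩ := ih hr.tail
      obtain rfl : a = u := by simpa using hu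
      refine ⟨b, rfl, P.append (.cons hadj .nil), (act_append _ _).2 ⟨_, hP, _,
        ⟨hr.tail, rfl, .inr ⟨?_, .refl _⟩⟩, hr, rfl, .refl _⟩⟩
      rintro ⟨l', hl'⟩
      exact hr _ (hl'.cons b) (.head _ _ _)
  obtain ⟨_, h1, P, hP⟩ := key h hr
  obtain ⟨_, h2, Q, hQ⟩ := key h' hr'
  simp only [List.head?_cons, Option.some.injEq] at h1 h2
  subst h1 h2
  have hPQ : X.Homotopic (P.append Q.reverse) .nil := hX.1.2 _ _
  obtain ⟨r, hr1, hr2⟩ := (act_append _ _).1 ((hX.2.act_congr hPQ).2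
    ⟨reduced_singleton v, rfl, .refl [v]⟩)
  have hr3 := hX.2.act_reverse hr2
  rw [SimpleGraph.Walk.reverse_reverse] at hr3
  exact (hX.2.act_unique hP hr1).trans (hX.2.act_unique hr3 hQ)

/-! ### Distances in the 1-skeleton -/

theorem HasBacktrack.exists_shorter {v : V} {p : List V} (h : HasBacktrack p)
    (hp : X.PathFrom v p) : ∃ q, X.PathFrom v q ∧ q.head? = p.head? ∧ q.length < p.length := by
  induction h with
  | head a b l => exact ⟨a :: l, hp.tail.tail, rfl, by simp⟩
  | @cons u p h ih =>
    match p with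
    | [] => cases h
    | a :: p =>
      obtain ⟨q, hq, hq', hl⟩ := ih hp.tail
      match q, hq' with
      | b :: q, hq' =>
        obtain rfl : b = a := by simpa using hq'
        refine ⟨u :: b :: q, .cons hq hp.adj, rfl, ?_⟩
        simpa using hl

theorem PathFrom.dist_le {v u : V} {l : List V} (h : X.PathFrom v (u :: l)) :
    X.graph.dist v u ≤ l.length := by
  suffices h : ∀ {p : List V}, X.PathFrom v p → ∃ u, p.head? = some u ∧
      ∃ P : X.graph.Walk v u, P.length + 1 = p.length by
    obtain ⟨u', hu, P, hP⟩ := h ‹_›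
    obtain rfl : u = u' := by simpa using hu
    have := X.graph.dist_le P
    simp only [List.length_cons] at hP
    omega
  intro p hp
  induction hp with
  | single => exact ⟨v, rfl, .nil, rfl⟩
  | @cons a b l hp hadj ih =>
    obtain ⟨u', hu, P, hP⟩ := ih
    obtain rfl : a = u' := by simpa using hu
    refine ⟨b, rfl, P.concat hadj, ?_⟩
    simp only [SimpleGraph.Walk.length_concat, hP, List.length_cons]

theorem exists_pathFrom {v u : V} (P : X.graph.Walk v u) :
    ∃ l, X.PathFrom v (u :: l) ∧ l.length = P.length := by
  induction P using SimpleGraph.Walk.concatRec with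
  | Hnil => exact ⟨[], .single, rfl⟩
  | Hconcat P h ih =>
    obtain ⟨l, hl, hl'⟩ := ih
    exact ⟨_ :: l, .cons hl h, by simp [hl']⟩

theorem PathFrom.reduced_of_length_eq {v u : V} {l : List V} (h : X.PathFrom v (u :: l))
    (hl : l.length = X.graph.dist v u) : X.Reduced (u :: l) := by
  intro q hq hb
  obtain ⟨r, hr, hr', hr''⟩ := hb.exists_shorter (h.sw hq)
  rw [← hq.head?_eq] at hr'
  match r, hr' with
  | a :: r, hr' =>
    obtain rfl : a = u := by simpa using hr'
    have h1 := hq.length_eq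
    have h2 := hr.dist_le
    simp only [List.length_cons] at *
    omega

theorem IsCAT0.connected (hX : X.IsCAT0) : X.graph.Connected := hX.1.1

theorem IsCAT0.exists_geodesic (hX : X.IsCAT0) (v u : V) :
    ∃ l, X.PathFrom v (u :: l) ∧ l.length = X.graph.dist v u := by
  obtain ⟨P, hP⟩ := hX.connected.exists_walk_length_eq_dist v u
  obtain ⟨l, hl, hl'⟩ := exists_pathFrom P
  exact ⟨l, hl, hl'.trans hP⟩

theorem IsCAT0.length_of_reduced (hX : X.IsCAT0) {v u : V} {l : List V}
    (h : X.PathFrom v (u :: l)) (hr : X.Reduced (u :: l)) : l.length = X.graph.dist v u := by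
  obtain ⟨l', hl', hl''⟩ := hX.exists_geodesic v u
  have := (hX.sw_of_reduced h hl' hr (hl'.reduced_of_length_eq hl'')).length_eq
  simp only [List.length_cons] at this
  omega

/-- The 1-skeleton is bipartite. -/
theorem IsCAT0.dist_adj (hX : X.IsCAT0) (v : V) {a b : V} (h : X.graph.Adj a b) :
    X.graph.dist v b = X.graph.dist v a + 1 ∨ X.graph.dist v a = X.graph.dist v b + 1 := by
  obtain ⟨l, hl, hl'⟩ := hX.exists_geodesic v a
  by_cases hr : X.Reduced (b :: a :: l)
  · left
    rw [← hX.length_of_reduced (hl.cons h) hr, ← hl', List.length_cons]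
  · right
    have hal := hl.reduced_of_length_eq hl'
    obtain ⟨m, hm⟩ := hX.2.sw_of_not_reduced hal hr
    rw [← hX.length_of_reduced (hl.sw hm).tail (hal.sw hm).tail, ← hl']
    have := hm.length_eq
    simpa using this

/-- The quadrangle condition. -/
theorem IsCAT0.exists_square (hX : X.IsCAT0) {v u a b : V} (ha : X.graph.Adj a u)
    (hb : X.graph.Adj b u) (hab : a ≠ b) (hda : X.graph.dist v u = X.graph.dist v a + 1)
    (hdb : X.graph.dist v u = X.graph.dist v b + 1) :
    ∃ c, X.IsSquare c a u b ∧ X.graph.dist v a = X.graph.dist v c + 1 := by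
  obtain ⟨l, hl, hl'⟩ := hX.exists_geodesic v a
  obtain ⟨m, hm, hm'⟩ := hX.exists_geodesic v b
  have h1 := (hl.cons ha).reduced_of_length_eq (by rw [hda, ← hl', List.length_cons])
  have h2 := (hm.cons hb).reduced_of_length_eq (by rw [hdb, ← hm', List.length_cons])
  obtain ⟨_, _, heq, h⟩ := hX.2.sw_cons_cons
    (hX.sw_of_reduced (hl.cons ha) (hm.cons hb) h1 h2) rfl
  simp only [List.cons.injEq, true_and] at heq
  obtain ⟨rfl, rfl⟩ := heq
  rcases h with ⟨h, -⟩ | ⟨c, k, hs, h3, -⟩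
  · exact absurd h hab
  · refine ⟨c, hs, ?_⟩
    rw [← hX.length_of_reduced (hl.sw h3).tail (h1.tail.sw h3).tail, ← hl']
    simpa using h3.length_eq

end Paths

/-! ### Halfspaces -/

section Halfspaces

variable {X : CubicalComplex V}

theorem IsCAT0.exists_adj_dist (hX : X.IsCAT0) {v u : V} (h : u ≠ v) :
    ∃ a, X.graph.Adj a u ∧ X.graph.dist v u = X.graph.dist v a + 1 := by
  obtain ⟨l, hl, hl'⟩ := hX.exists_geodesic v u
  match l with
  | [] => cases hl; exact absurd rfl h
  | a :: l =>
    refine ⟨a, hl.adj, ?_⟩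
    have h1 := hl.tail.dist_le
    have h2 := hX.dist_adj v hl.adj
    simp only [List.length_cons] at hl'
    omega

/-- The vertices nearer to `a` than to `b`. -/
def nearer (X : CubicalComplex V) (a b : V) : Set V := {v | X.graph.dist v a < X.graph.dist v b}

theorem mem_nearer {a b v : V} : v ∈ X.nearer a b ↔ X.graph.dist v a < X.graph.dist v b := Iff.rfl

theorem mem_nearer' {a b v : V} : v ∈ X.nearer a b ↔ X.graph.dist a v < X.graph.dist b v := by
  rw [mem_nearer, X.graph.dist_comm, X.graph.dist_comm (v := b)]

theorem IsCAT0.compl_nearer (hX : X.IsCAT0) {a b : V} (h : X.graph.Adj a b) :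
    (X.nearer a b)ᶜ = X.nearer b a := by
  ext v
  have := hX.dist_adj v h
  simp only [mem_compl_iff, mem_nearer]
  omega

theorem left_mem_nearer {a b : V} (h : X.graph.Adj a b) : a ∈ X.nearer a b := by
  rw [mem_nearer, SimpleGraph.dist_self, SimpleGraph.dist_eq_one_iff_adj.2 h]
  exact one_pos

theorem right_notMem_nearer {a b : V} : b ∉ X.nearer a b := by
  simp [mem_nearer]

/-- Opposite sides of a square determine the same halfspaces. -/
theorem IsCAT0.nearer_subset_of_square (hX : X.IsCAT0) {a b c d : V} (hs : X.IsSquare a b c d) :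
    X.nearer a b ⊆ X.nearer d c := by
  intro v hv
  rw [mem_nearer] at *
  have h1 := hX.dist_adj v hs.1
  have h2 := hX.dist_adj v hs.2.1
  have h3 := hX.dist_adj v hs.2.2.1
  have h4 := hX.dist_adj v hs.2.2.2.1
  by_contra hcon
  obtain ⟨e, he, hd⟩ := hX.exists_square (v := v) hs.1 hs.2.1.symm hs.2.2.2.2.1
    (by omega) (by omega)
  obtain rfl : d = e := hs.unique he.rotate
  omega

theorem IsCAT0.nearer_eq_of_square (hX : X.IsCAT0) {a b c d : V} (hs : X.IsSquare a b c d) :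
    X.nearer a b = X.nearer d c :=
  (hX.nearer_subset_of_square hs).antisymm
    (hX.nearer_subset_of_square hs.rotate.rotate.reflect.rotate.rotate.rotate)

/-- The halfspaces determined by an edge. -/
def edgeHalfspaces (X : CubicalComplex V) (e : Sym2 V) : Set (Set V) :=
  {h | ∃ a b, e = s(a, b) ∧ X.graph.Adj a b ∧ h = X.nearer a b}

theorem IsCAT0.edgeHalfspaces_congr (hX : X.IsCAT0) {e f : Sym2 V}
    (h : Relation.EqvGen X.Opposite e f) : X.edgeHalfspaces e = X.edgeHalfspaces f := by
  have key : ∀ {a b c d : V}, X.IsSquare a b c d →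
      X.edgeHalfspaces s(a, b) ⊆ X.edgeHalfspaces s(d, c) := by
    rintro a b c d hs _ ⟨p, q, h1, h2, rfl⟩
    rcases Sym2.eq_iff.1 h1 with ⟨rfl, rfl⟩ | ⟨rfl, rfl⟩
    · exact ⟨d, c, rfl, hs.2.2.1.symm, hX.nearer_eq_of_square hs⟩
    · refine ⟨c, d, Sym2.eq_swap, hs.2.2.1, ?_⟩
      exact hX.nearer_eq_of_square hs.reflect.rotate.rotate.rotate
  induction h with
  | rel e f h =>
    obtain ⟨a, b, c, d, hs, rfl, rfl⟩ := h
    exact (key hs).antisymm (key hs.rotate.rotate.reflect.rotate.rotate.rotate)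
  | refl => rfl
  | symm _ _ _ ih => exact ih.symm
  | trans _ _ _ _ _ ih1 ih2 => exact ih1.trans ih2

/-- An edge between complementary halfspaces crosses their hyperplane. -/
theorem IsCAT0.eqvGen_of_mem_nearer (hX : X.IsCAT0) {a b p q : V} (hab : X.graph.Adj a b)
    (hpq : X.graph.Adj p q) (hp : p ∈ X.nearer a b) (hq : q ∉ X.nearer a b) :
    Relation.EqvGen X.Opposite s(a, b) s(p, q) := by
  induction hn : X.graph.dist a p using Nat.strong_induction_on generalizing p q with
  | _ n IH =>
    subst hn
    have h1 := hX.dist_adj a hpq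
    have h2 := hX.dist_adj b hpq
    have h3 := hX.dist_adj p hab
    have h4 := hX.dist_adj q hab
    rw [mem_nearer'] at hp
    rw [mem_nearer'] at hq
    rw [SimpleGraph.dist_comm (u := p), SimpleGraph.dist_comm (u := p)] at h3
    rw [SimpleGraph.dist_comm (u := q), SimpleGraph.dist_comm (u := q)] at h4
    by_cases hpa : p = a
    · subst hpa
      have h5 := X.graph.dist_self (v := p)
      obtain rfl : b = q := (hX.connected.dist_eq_zero_iff).1 (by omega)
      exact .refl _
    · obtain ⟨r, hr, hr'⟩ := hX.exists_adj_dist hpa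
      have h5 := hX.dist_adj b hr
      have h6 := hX.dist_adj r hab
      rw [SimpleGraph.dist_comm (u := r), SimpleGraph.dist_comm (u := r)] at h6
      have hrq : r ≠ q := by rintro rfl; omega
      obtain ⟨t, ht, ht'⟩ := hX.exists_square (v := b) hr hpq.symm hrq (by omega) (by omega)
      have h7 := hX.dist_adj a ht.1
      have h8 := hX.dist_adj a ht.2.2.2.1
      have h9 := hX.dist_adj t hab
      rw [SimpleGraph.dist_comm (u := t), SimpleGraph.dist_comm (u := t)] at h9
      refine .trans _ _ _ (IH _ ?_ ht.1.symm ?_ ?_ rfl) (.rel _ _ ⟨r, t, q, p,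
        ht.reflect.rotate.rotate.rotate, rfl, rfl⟩)
      · omega
      · rw [mem_nearer']
        omega
      · rw [mem_nearer']
        omega

theorem IsCAT0.component_eq_nearer (hX : X.IsCAT0) {a b v : V} (hab : X.graph.Adj a b)
    (hv : v ∈ X.nearer a b) :
    {u | (X.graph.deleteEdges {f | Relation.EqvGen X.Opposite s(a, b) f}).Reachable v u} =
      X.nearer a b := by
  set w : Set (Sym2 V) := {f | Relation.EqvGen X.Opposite s(a, b) f}
  -- edges in the hyperplane have exactly one endpoint in the halfspace
  have hcross : ∀ {p q : V}, s(p, q) ∈ w → X.graph.Adj p q →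
      (p ∈ X.nearer a b ↔ q ∉ X.nearer a b) := by
    intro p q hpq hadj
    have : X.nearer p q ∈ X.edgeHalfspaces s(a, b) := by
      rw [hX.edgeHalfspaces_congr hpq]
      exact ⟨p, q, rfl, hadj, rfl⟩
    obtain ⟨a', b', h1, h2, h3⟩ := this
    have hpn := left_mem_nearer hadj
    have hqn : q ∉ X.nearer p q := right_notMem_nearer
    rcases Sym2.eq_iff.1 h1 with ⟨rfl, rfl⟩ | ⟨rfl, rfl⟩
    · rw [h3] at hpn hqn; tauto
    · rw [h3, ← hX.compl_nearer hab] at hpn hqn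
      simp only [mem_compl_iff] at hpn hqn
      tauto
  have hadj : ∀ {p q : V}, (X.graph.deleteEdges w).Adj p q →
      (p ∈ X.nearer a b ↔ q ∈ X.nearer a b) := by
    intro p q hpq
    rw [SimpleGraph.deleteEdges_adj] at hpq
    constructor
    · intro hp
      by_contra hq
      exact hpq.2 (hX.eqvGen_of_mem_nearer hab hpq.1 hp hq)
    · intro hq
      by_contra hp
      refine hpq.2 ?_
      rw [Sym2.eq_swap]
      exact hX.eqvGen_of_mem_nearer hab hpq.1.symm hq hp
  have hreach : ∀ {p : V}, p ∈ X.nearer a b → (X.graph.deleteEdges w).Reachable p a := by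
    intro p hp
    induction hn : X.graph.dist a p using Nat.strong_induction_on generalizing p with
    | _ n IH =>
      subst hn
      by_cases hpa : p = a
      · rw [hpa]
      · obtain ⟨r, hr, hr'⟩ := hX.exists_adj_dist hpa
        have h1 := hX.dist_adj b hr
        have hrn : r ∈ X.nearer a b := by
          rw [mem_nearer'] at hp ⊢
          have h2 := hX.dist_adj p hab
          rw [X.graph.dist_comm, X.graph.dist_comm (v := a)] at h2
          omega
        refine SimpleGraph.Reachable.trans (SimpleGraph.Adj.reachable ?_) (IH _ (by omega) hrn rfl)
        rw [SimpleGraph.deleteEdges_adj]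
        exact ⟨hr.symm, fun hmem => (hcross hmem hr.symm).1 hp hrn⟩
  ext u
  constructor
  · rintro ⟨P⟩
    induction P with
    | nil => exact hv
    | cons h P ih => exact ih ((hadj h).1 hv)
  · intro hu
    exact (hreach hv).trans (hreach hu).symm

theorem IsCAT0.isSide_iff (hX : X.IsCAT0) {a b : V} (hab : X.graph.Adj a b) {h : Set V} :
    X.IsSide {f | Relation.EqvGen X.Opposite s(a, b) f} h ↔
      h = X.nearer a b ∨ h = X.nearer b a := by
  have hswap := fun v => hX.component_eq_nearer (v := v) hab.symm
  rw [Sym2.eq_swap] at hswap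
  constructor
  · rintro ⟨v, rfl⟩
    by_cases hv : v ∈ X.nearer a b
    · exact .inl (hX.component_eq_nearer hab hv)
    · rw [← mem_compl_iff, hX.compl_nearer hab] at hv
      exact .inr (hswap v hv)
  · rintro (rfl | rfl)
    · exact ⟨a, (hX.component_eq_nearer hab (left_mem_nearer hab)).symm⟩
    · exact ⟨b, (hswap b (left_mem_nearer hab.symm)).symm⟩

theorem isHyperplane_of_adj {a b : V} (hab : X.graph.Adj a b) :
    X.IsHyperplane {f | Relation.EqvGen X.Opposite s(a, b) f} :=
  ⟨s(a, b), hab, rfl⟩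

theorem IsHyperplane.exists_adj {w : Set (Sym2 V)} (hw : X.IsHyperplane w) :
    ∃ a b, X.graph.Adj a b ∧ w = {f | Relation.EqvGen X.Opposite s(a, b) f} := by
  obtain ⟨e, he, rfl⟩ := hw
  induction e with
  | _ a b => exact ⟨a, b, he, rfl⟩

theorem IsCAT0.isHalfspace_iff (hX : X.IsCAT0) {h : Set V} :
    X.IsHalfspace h ↔ ∃ a b, X.graph.Adj a b ∧ h = X.nearer a b := by
  constructor
  · rintro ⟨w, hw, hs⟩
    obtain ⟨a, b, hab, rfl⟩ := hw.exists_adj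
    rcases (hX.isSide_iff hab).1 hs with rfl | rfl
    exacts [⟨a, b, hab, rfl⟩, ⟨b, a, hab.symm, rfl⟩]
  · rintro ⟨a, b, hab, rfl⟩
    exact ⟨_, isHyperplane_of_adj hab, (hX.isSide_iff hab).2 (.inl rfl)⟩

theorem IsCAT0.isHalfspace_nearer (hX : X.IsCAT0) {a b : V} (hab : X.graph.Adj a b) :
    X.IsHalfspace (X.nearer a b) := hX.isHalfspace_iff.2 ⟨a, b, hab, rfl⟩

theorem IsCAT0.isHalfspace_compl (hX : X.IsCAT0) {h : Set V} (hh : X.IsHalfspace h) :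
    X.IsHalfspace hᶜ := by
  obtain ⟨a, b, hab, rfl⟩ := hX.isHalfspace_iff.1 hh
  rw [hX.compl_nearer hab]
  exact hX.isHalfspace_nearer hab.symm

theorem IsHalfspace.nonempty {h : Set V} (hh : X.IsHalfspace h) : h.Nonempty := by
  obtain ⟨w, -, v, rfl⟩ := hh
  exact ⟨v, SimpleGraph.Reachable.refl v⟩

/-- Every edge that leaves a halfspace determines it. -/
theorem IsCAT0.eq_nearer (hX : X.IsCAT0) {h : Set V} (hh : X.IsHalfspace h) {p q : V}
    (hpq : X.graph.Adj p q) (hp : p ∈ h) (hq : q ∉ h) : h = X.nearer p q := by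
  obtain ⟨a, b, hab, rfl⟩ := hX.isHalfspace_iff.1 hh
  have : X.nearer a b ∈ X.edgeHalfspaces s(p, q) := by
    rw [← hX.edgeHalfspaces_congr (hX.eqvGen_of_mem_nearer hab hpq hp hq)]
    exact ⟨a, b, rfl, hab, rfl⟩
  obtain ⟨p', q', h1, h2, h3⟩ := this
  rcases Sym2.eq_iff.1 h1 with ⟨rfl, rfl⟩ | ⟨rfl, rfl⟩
  · exact h3
  · rw [h3] at hp
    exact absurd hp right_notMem_nearer

/-- The halfspaces that contain `u` but not `v`. -/
def separators (X : CubicalComplex V) (u v : V) : Set (Set V) :=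
  {h | X.IsHalfspace h ∧ u ∈ h ∧ v ∉ h}

theorem IsCAT0.encard_separators (hX : X.IsCAT0) (u v : V) :
    (X.separators u v).encard = X.graph.dist u v := by
  induction hn : X.graph.dist u v generalizing v with
  | zero =>
    obtain rfl := hX.connected.dist_eq_zero_iff.1 hn
    have : X.separators u u = ∅ := by
      ext h; simp [separators]
    simp [this]
  | succ n ih =>
    have huv : v ≠ u := by rintro rfl; simp at hn
    obtain ⟨a, ha, had⟩ := hX.exists_adj_dist huv
    have hua : u ∈ X.nearer a v := by rw [mem_nearer]; omega
    have : X.separators u v = insert (X.nearer a v) (X.separators u a) := by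
      ext h
      simp only [separators, mem_ofPred_eq, mem_insert_iff]
      constructor
      · rintro ⟨h1, h2, h3⟩
        by_cases hah : a ∈ h
        · exact .inl (hX.eq_nearer h1 ha hah h3)
        · exact .inr ⟨h1, h2, hah⟩
      · rintro (rfl | ⟨h1, h2, h3⟩)
        · exact ⟨hX.isHalfspace_nearer ha, hua, right_notMem_nearer⟩
        · refine ⟨h1, h2, fun hv => ?_⟩
          rw [hX.eq_nearer h1 ha.symm hv h3, mem_nearer] at h2
          omega
    rw [this, Set.encard_insert_of_notMem (fun h => h.2.2 (left_mem_nearer ha)), ih a (by omega)]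
    norm_cast

theorem IsCAT0.finite_separators (hX : X.IsCAT0) (u v : V) : (X.separators u v).Finite := by
  rw [← Set.encard_ne_top_iff, hX.encard_separators]
  exact ENat.natCast_ne_top _

theorem IsCAT0.exists_separator (hX : X.IsCAT0) {u v : V} (huv : u ≠ v) :
    ∃ h, X.IsHalfspace h ∧ u ∈ h ∧ v ∉ h := by
  by_contra hcon
  have : X.separators u v = ∅ := by
    ext h
    simp only [mem_empty_iff_false, iff_false]
    exact fun hh => hcon ⟨h, hh⟩
  have h1 := hX.encard_separators u v
  rw [this, Set.encard_empty] at h1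
  exact huv (hX.connected.dist_eq_zero_iff.1 (by exact_mod_cast h1.symm))

/-! ### Medians of vertices and the Helly property -/

/-- `m` lies on a geodesic between `u` and `v`. -/
def Between (X : CubicalComplex V) (u m v : V) : Prop :=
  X.graph.dist u m + X.graph.dist m v = X.graph.dist u v

/-- Halfspaces are convex. -/
theorem IsCAT0.mem_of_between (hX : X.IsCAT0) {u m v : V} (hm : X.Between u m v) {h : Set V}
    (hh : X.IsHalfspace h) (hu : u ∈ h) (hv : v ∈ h) : m ∈ h := by
  by_contra hmh
  have hsub : insert h (X.separators u v) ⊆ X.separators u m ∪ X.separators m v := by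
    rintro k (rfl | ⟨h1, h2, h3⟩)
    · exact .inl ⟨hh, hu, hmh⟩
    · by_cases hk : m ∈ k
      · exact .inr ⟨h1, hk, h3⟩
      · exact .inl ⟨h1, h2, hk⟩
  have h1 := (Set.encard_le_encard hsub).trans (Set.encard_union_le _ _)
  rw [Set.encard_insert_of_notMem (fun h => h.2.2 hv), hX.encard_separators, hX.encard_separators,
    hX.encard_separators, ← hm] at h1
  norm_cast at h1
  omega

/-- A triple with `v ≠ w` can be shrunk at `v` or at `w`: one of them has a neighbour that is nearer
to both other vertices. Induction on the distance of `v` and `w`, using the quadrangle condition. -/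
theorem IsCAT0.exists_adj_nearer (hX : X.IsCAT0) (u : V) {v w : V} (hvw : v ≠ w) :
    (∃ a, X.graph.Adj a v ∧ X.graph.dist u v = X.graph.dist u a + 1 ∧
      X.graph.dist w v = X.graph.dist w a + 1) ∨
    (∃ a, X.graph.Adj a w ∧ X.graph.dist u w = X.graph.dist u a + 1 ∧
      X.graph.dist v w = X.graph.dist v a + 1) := by
  induction hn : X.graph.dist w v generalizing v with
  | zero => exact absurd (hX.connected.dist_eq_zero_iff.1 hn).symm hvw
  | succ n ih =>
    obtain ⟨a, ha, had⟩ := hX.exists_adj_dist hvw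
    rcases hX.dist_adj u ha with h | h
    · exact .inl ⟨a, ha, h, by omega⟩
    by_cases haw : a = w
    · subst haw
      exact .inr ⟨v, ha.symm, h, by simp [SimpleGraph.dist_eq_one_iff_adj.2 ha.symm]⟩
    rcases ih haw (by omega) with ⟨b, hb, hb1, hb2⟩ | ⟨b, hb, hb1, hb2⟩
    · have hvb : v ≠ b := by rintro rfl; omega
      obtain ⟨c, hc, hcd⟩ := hX.exists_square ha.symm hb hvb h hb1
      have h1 := hX.dist_adj w hc.1
      have h2 := hX.dist_adj w hc.2.2.2.1
      exact .inl ⟨c, hc.1, hcd, by omega⟩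
    · have h1 := hX.dist_adj v hb
      have h2 := hX.connected.dist_triangle (u := v) (v := a) (w := b)
      rw [SimpleGraph.dist_eq_one_iff_adj.2 ha.symm] at h2
      have h3 := X.graph.dist_comm (u := v) (v := w)
      have h4 := X.graph.dist_comm (u := a) (v := w)
      exact .inr ⟨b, hb, hb1, by omega⟩

theorem IsCAT0.exists_median (hX : X.IsCAT0) (u v w : V) :
    ∃ m, X.Between u m v ∧ X.Between v m w ∧ X.Between w m u := by
  have step : ∀ {x y a m : V}, X.graph.Adj a y → X.graph.dist x y = X.graph.dist x a + 1 →
      X.Between x m a → X.Between x m y := by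
    intro x y a m ha hd hm
    rw [Between] at *
    have h1 := hX.dist_adj m ha
    have h2 := hX.connected.dist_triangle (u := x) (v := m) (w := y)
    omega
  have bsymm : ∀ {x y m : V}, X.Between x m y → X.Between y m x := by
    intro x y m hm
    rw [Between] at *
    have h1 := X.graph.dist_comm (u := x) (v := m)
    have h2 := X.graph.dist_comm (u := m) (v := y)
    have h3 := X.graph.dist_comm (u := x) (v := y)
    omega
  induction hn : X.graph.dist u v + X.graph.dist v w + X.graph.dist w u using
    Nat.strong_induction_on generalizing v w with
  | _ n IH =>
    subst hn
    by_cases hvw : v = w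
    · subst hvw
      exact ⟨v, by simp [Between], by simp [Between], by simp [Between]⟩
    have c1 := X.graph.dist_comm (u := v) (v := w)
    have c2 := X.graph.dist_comm (u := u) (v := w)
    rcases hX.exists_adj_nearer u hvw with ⟨a, ha, h1, h2⟩ | ⟨a, ha, h1, h2⟩
    · obtain ⟨m, hm1, hm2, hm3⟩ := IH _ (by
        have c3 := X.graph.dist_comm (u := a) (v := w)
        omega) a w rfl
      exact ⟨m, step ha h1 hm1, bsymm (step ha h2 (bsymm hm2)), hm3⟩
    · obtain ⟨m, hm1, hm2, hm3⟩ := IH _ (by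
        have c3 := X.graph.dist_comm (u := a) (v := u)
        omega) v a rfl
      exact ⟨m, hm1, step ha h2 hm2, bsymm (step ha h1 (bsymm hm3))⟩

/-- The Helly property, for sets closed under taking points between two of their elements. -/
theorem IsCAT0.helly (hX : X.IsCAT0) {ι : Type*} (s : Finset ι) (hs : s.Nonempty)
    (F : ι → Set V) (hconv : ∀ i ∈ s, ∀ u ∈ F i, ∀ v ∈ F i, ∀ m, X.Between u m v → m ∈ F i)
    (hF : ∀ i ∈ s, ∀ j ∈ s, (F i ∩ F j).Nonempty) : ∃ v, ∀ i ∈ s, v ∈ F i := by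
  classical
  induction s using Finset.induction_on generalizing F with
  | empty => simp at hs
  | insert i s hi ih =>
    rcases s.eq_empty_or_nonempty with rfl | hs'
    · obtain ⟨v, hv, -⟩ := hF i (by simp) i (by simp)
      exact ⟨v, by simpa using hv⟩
    have hmem : ∀ j ∈ s, j ∈ insert i s := fun j hj => Finset.mem_insert_of_mem hj
    obtain ⟨v, hv⟩ := ih hs' (fun j => F i ∩ F j)
      (fun j hj u hu v hv m hm => ⟨hconv i (by simp) u hu.1 v hv.1 m hm,
        hconv j (hmem j hj) u hu.2 v hv.2 m hm⟩)
      (fun j hj k hk => by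
        obtain ⟨x, hx⟩ := hF i (by simp) j (hmem j hj)
        obtain ⟨y, hy⟩ := hF j (hmem j hj) k (hmem k hk)
        obtain ⟨z, hz⟩ := hF k (hmem k hk) i (by simp)
        obtain ⟨m, h1, h2, h3⟩ := hX.exists_median x y z
        have hi := hconv i (by simp) z hz.2 x hx.1 m h3
        exact ⟨m, ⟨hi, hconv j (hmem j hj) x hx.2 y hy.1 m h1⟩,
          ⟨hi, hconv k (hmem k hk) y hy.2 z hz.1 m h2⟩⟩)
    obtain ⟨j, hj⟩ := hs'
    refine ⟨v, fun k hk => ?_⟩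
    rcases Finset.mem_insert.1 hk with rfl | hk
    · exact (hv j hj).1
    · exact (hv k hk).2

theorem IsCAT0.helly_halfspaces (hX : X.IsCAT0) {S : Set (Set V)} (hfin : S.Finite)
    (hne : S.Nonempty) (hS : ∀ h ∈ S, X.IsHalfspace h)
    (hint : ∀ h ∈ S, ∀ k ∈ S, (h ∩ k).Nonempty) : ∃ v, ∀ h ∈ S, v ∈ h := by
  obtain ⟨v, hv⟩ := hX.helly hfin.toFinset (by simpa using hne) id
    (fun h hh u hu v hv m hm => hX.mem_of_between hm (hS h (by simpa using hh)) hu hv)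
    (fun h hh k hk => hint h (by simpa using hh) k (by simpa using hk))
  exact ⟨v, fun h hh => hv h (by simpa using hh)⟩

/-! ### Maximal halfspaces that avoid a vertex -/

/-- `k` is maximal among the halfspaces that do not contain `v`. -/
def IsMaxAvoiding (X : CubicalComplex V) (v : V) (k : Set V) : Prop :=
  X.IsHalfspace k ∧ v ∉ k ∧ ∀ j, X.IsHalfspace j → v ∉ j → k ⊆ j → j = k

theorem IsCAT0.exists_isMaxAvoiding (hX : X.IsCAT0) {v : V} {h : Set V} (hh : X.IsHalfspace h)
    (hv : v ∉ h) : ∃ k, X.IsMaxAvoiding v k ∧ h ⊆ k := by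
  obtain ⟨u, hu⟩ := hh.nonempty
  obtain ⟨k, hk, hmax⟩ := (hX.finite_separators u v).exists_le_maximal
    (show h ∈ X.separators u v from ⟨hh, hu, hv⟩)
  refine ⟨k, ⟨hmax.1.1, hmax.1.2.2, fun j hj hvj hkj => ?_⟩, hk⟩
  exact (hmax.2 ⟨hj, hkj hmax.1.2.1, hvj⟩ hkj).antisymm hkj

/-- A maximal halfspace that avoids `v` contains a neighbour of `v`. -/
theorem IsCAT0.exists_adj_of_isMaxAvoiding (hX : X.IsCAT0) {v : V} {k : Set V}
    (hk : X.IsMaxAvoiding v k) : ∃ a, X.graph.Adj v a ∧ k = X.nearer a v := by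
  obtain ⟨hk1, hvk, hmax⟩ := hk
  obtain ⟨u, hu⟩ := hk1.nonempty
  obtain ⟨g, hg⟩ := hX.helly_halfspaces (S := insert k (X.separators v u \ {kᶜ}))
    (((hX.finite_separators v u).subset sdiff_subset).insert k) ⟨k, by simp⟩
    (by
      rintro h (rfl | h)
      exacts [hk1, h.1.1])
    (by
      have key : ∀ j ∈ X.separators v u \ {kᶜ}, (k ∩ j).Nonempty := by
        rintro j ⟨⟨h1, h2, h3⟩, h4⟩
        by_contra hcon
        rw [Set.not_nonempty_iff_eq_empty, ← Set.disjoint_iff_inter_eq_empty] at hcon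
        have := hmax jᶜ (hX.isHalfspace_compl h1) (by simpa using h2)
          hcon.subset_compl_right
        exact h4 (by rw [← this, compl_compl]; rfl)
      rintro h (rfl | h1) j (rfl | h2)
      · exact ⟨u, hu, hu⟩
      · exact key j h2
      · rw [inter_comm]; exact key h h1
      · exact ⟨v, h1.1.2.1, h2.1.2.1⟩)
  obtain ⟨m, hm1, hm2, hm3⟩ := hX.exists_median g u v
  have hmk : m ∈ k := hX.mem_of_between hm1 hk1 (hg k (by simp)) hu
  have hsub : X.separators v m ⊆ {kᶜ} := by
    rintro j ⟨h1, h2, h3⟩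
    by_contra hj
    by_cases huj : u ∈ j
    · exact h3 (hX.mem_of_between hm2 h1 huj h2)
    · exact h3 (hX.mem_of_between hm3 h1 h2 (hg j (.inr ⟨⟨h1, h2, huj⟩, hj⟩)))
  have hle := Set.encard_le_encard hsub
  rw [hX.encard_separators, Set.encard_singleton] at hle
  have hne : X.graph.dist v m ≠ 0 := fun h0 => by
    rw [hX.connected.dist_eq_zero_iff.1 h0] at hvk
    exact hvk hmk
  have hadj : X.graph.Adj v m := by
    rw [← SimpleGraph.dist_eq_one_iff_adj]
    have : X.graph.dist v m ≤ 1 := by exact_mod_cast hle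
    omega
  exact ⟨m, hadj, hX.eq_nearer hk1 hadj.symm hmk hvk⟩

theorem IsCAT0.finite_isMaxAvoiding (hX : X.IsCAT0) (hf : X.LocallyFinite) (v : V) :
    {k | X.IsMaxAvoiding v k}.Finite := by
  refine ((hf v).image fun a => X.nearer a v).subset ?_
  intro k hk
  obtain ⟨a, ha, rfl⟩ := hX.exists_adj_of_isMaxAvoiding hk
  exact ⟨a, ha, rfl⟩

/-- Halfspaces that intersect, neither of which contains the other, and that avoid a common
vertex, are transverse. -/
theorem transverse_of_not_subset {h k : Set V} {v : V} (hhk : (h ∩ k).Nonempty) (hv : v ∉ h)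
    (hv' : v ∉ k) (h1 : ¬ h ⊆ k) (h2 : ¬ k ⊆ h) : Transverse h k := by
  rw [Set.not_subset] at h1 h2
  obtain ⟨a, ha, ha'⟩ := h1
  obtain ⟨b, hb, hb'⟩ := h2
  exact ⟨hhk, ⟨b, hb', hb⟩, ⟨a, ha, ha'⟩, ⟨v, hv, hv'⟩⟩

end Halfspaces

/-! ### The Roller compactification -/

section RollerPoints

variable {X : CubicalComplex V}

theorem mem_ofVertex {v : V} {h : Set V} :
    h ∈ (X.ofVertex v).halfspaces ↔ X.IsHalfspace h ∧ v ∈ h := Iff.rfl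

theorem IsCAT0.mem_or_compl_mem (hX : X.IsCAT0) (x : X.Roller) {h : Set V}
    (hh : X.IsHalfspace h) : h ∈ x.halfspaces ∨ hᶜ ∈ x.halfspaces := by
  obtain ⟨a, b, hab, rfl⟩ := hX.isHalfspace_iff.1 hh
  obtain ⟨k, hk, hs⟩ := x.exists_side _ (isHyperplane_of_adj hab)
  rw [hX.compl_nearer hab]
  rcases (hX.isSide_iff hab).1 hs with rfl | rfl
  exacts [.inl hk, .inr hk]

theorem IsCAT0.compl_mem_iff (hX : X.IsCAT0) (x : X.Roller) {h : Set V}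
    (hh : X.IsHalfspace h) : hᶜ ∈ x.halfspaces ↔ h ∉ x.halfspaces := by
  constructor
  · intro h1 h2
    obtain ⟨v, hv, hv'⟩ := x.inter_nonempty _ h1 _ h2
    exact hv hv'
  · intro h1
    exact (hX.mem_or_compl_mem x hh).resolve_left h1

theorem IsCAT0.mem_of_subset (hX : X.IsCAT0) {x : X.Roller} {h k : Set V}
    (hh : h ∈ x.halfspaces) (hk : X.IsHalfspace k) (hhk : h ⊆ k) : k ∈ x.halfspaces := by
  by_contra hcon
  obtain ⟨v, hv, hv'⟩ := x.inter_nonempty _ hh _ ((hX.compl_mem_iff x hk).2 hcon)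
  exact hv' (hhk hv)

theorem IsCAT0.roller_eq (hX : X.IsCAT0) {x y : X.Roller} (h : x.halfspaces ⊆ y.halfspaces) :
    x = y := by
  refine Roller.ext (h.antisymm fun k hk => ?_)
  by_contra hcon
  have hk' := y.isHalfspace k hk
  exact (hX.compl_mem_iff y hk').1 (h ((hX.compl_mem_iff x hk').2 hcon)) hk

theorem IsCAT0.ofVertex_injective (hX : X.IsCAT0) : Function.Injective X.ofVertex := by
  intro u v huv
  by_contra hne
  obtain ⟨h, h1, h2, h3⟩ := hX.exists_separator hne
  have : h ∈ (X.ofVertex u).halfspaces := ⟨h1, h2⟩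
  rw [huv] at this
  exact h3 this.2

theorem IsCAT0.exists_isMedian (hX : X.IsCAT0) (x y z : X.Roller) : ∃ m, X.IsMedian x y z m := by
  refine ⟨⟨{h | (h ∈ x.halfspaces ∧ h ∈ y.halfspaces) ∨ (h ∈ y.halfspaces ∧ h ∈ z.halfspaces) ∨
    (h ∈ z.halfspaces ∧ h ∈ x.halfspaces)}, ?_, ?_, ?_⟩, ?_, ?_, ?_⟩
  · rintro h (hh | hh | hh)
    exacts [x.isHalfspace h hh.1, y.isHalfspace h hh.1, z.isHalfspace h hh.1]
  · -- two majorities among three points have a common member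
    rintro h hh k hk
    have : (h ∈ x.halfspaces ∧ k ∈ x.halfspaces) ∨ (h ∈ y.halfspaces ∧ k ∈ y.halfspaces) ∨
        (h ∈ z.halfspaces ∧ k ∈ z.halfspaces) := by
      simp only [mem_ofPred_eq] at hh hk
      tauto
    rcases this with h | h | h
    exacts [x.inter_nonempty _ h.1 _ h.2, y.inter_nonempty _ h.1 _ h.2,
      z.inter_nonempty _ h.1 _ h.2]
  · intro w hw
    obtain ⟨a, b, hab, rfl⟩ := hw.exists_adj
    have hx := hX.compl_mem_iff x (hX.isHalfspace_nearer hab)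
    have hy := hX.compl_mem_iff y (hX.isHalfspace_nearer hab)
    have hz := hX.compl_mem_iff z (hX.isHalfspace_nearer hab)
    rw [hX.compl_nearer hab] at hx hy hz
    by_cases hmaj : (X.nearer a b ∈ x.halfspaces ∧ X.nearer a b ∈ y.halfspaces) ∨
      (X.nearer a b ∈ y.halfspaces ∧ X.nearer a b ∈ z.halfspaces) ∨
      (X.nearer a b ∈ z.halfspaces ∧ X.nearer a b ∈ x.halfspaces)
    · exact ⟨_, hmaj, (hX.isSide_iff hab).2 (.inl rfl)⟩
    · refine ⟨X.nearer b a, ?_, (hX.isSide_iff hab).2 (.inr rfl)⟩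
      simp only [mem_ofPred_eq, hx, hy, hz]
      tauto
  · exact fun h h1 h2 => .inl ⟨h1, h2⟩
  · exact fun h h1 h2 => .inr (.inl ⟨h1, h2⟩)
  · exact fun h h1 h2 => .inr (.inr ⟨h1, h2⟩)

/-- A halfspace contains the median if and only if it contains a majority of the three points. -/
theorem IsCAT0.mem_isMedian_iff (hX : X.IsCAT0) {x y z m : X.Roller} (hm : X.IsMedian x y z m)
    {h : Set V} (hh : X.IsHalfspace h) : h ∈ m.halfspaces ↔
      (h ∈ x.halfspaces ∧ h ∈ y.halfspaces) ∨ (h ∈ y.halfspaces ∧ h ∈ z.halfspaces) ∨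
        (h ∈ z.halfspaces ∧ h ∈ x.halfspaces) := by
  have h1 := hm.1 h
  have h2 := hm.2.1 h
  have h3 := hm.2.2 h
  have h1' := hm.1 hᶜ
  have h2' := hm.2.1 hᶜ
  have h3' := hm.2.2 hᶜ
  rw [hX.compl_mem_iff _ hh, hX.compl_mem_iff _ hh, hX.compl_mem_iff _ hh] at h1' h2' h3'
  by_cases hx : h ∈ x.halfspaces <;> by_cases hy : h ∈ y.halfspaces <;>
    by_cases hz : h ∈ z.halfspaces <;> simp_all

theorem IsCAT0.isMedian_unique (hX : X.IsCAT0) {x y z m m' : X.Roller} (hm : X.IsMedian x y z m)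
    (hm' : X.IsMedian x y z m') : m = m' :=
  hX.roller_eq fun h hh => by
    have hh' := m.isHalfspace h hh
    rwa [hX.mem_isMedian_iff hm' hh', ← hX.mem_isMedian_iff hm hh']

theorem IsCAT0.eq_of_isMedian_ofVertex (hX : X.IsCAT0) {x y z : X.Roller} {u v : V}
    (hu : X.IsMedian x y z (X.ofVertex u)) (hv : X.IsMedian x y z (X.ofVertex v)) : u = v :=
  hX.ofVertex_injective (hX.isMedian_unique hu hv)

/-- An ultrafilter that differs from that of a vertex in finitely many hyperplanes is a vertex. -/
theorem IsCAT0.exists_eq_ofVertex (hX : X.IsCAT0) {x : X.Roller} {v : V}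
    (hfin : {h | h ∈ x.halfspaces ∧ v ∉ h}.Finite) : x ∈ range X.ofVertex := by
  set F := {h | h ∈ x.halfspaces ∧ v ∉ h}
  rcases F.eq_empty_or_nonempty with hemp | hne
  · refine ⟨v, (hX.roller_eq (y := X.ofVertex v) fun h hh => ⟨x.isHalfspace h hh, ?_⟩).symm⟩
    by_contra hv
    exact hemp.subset (show h ∈ F from ⟨hh, hv⟩)
  · obtain ⟨g, hg⟩ := hX.helly_halfspaces hfin hne (fun h hh => x.isHalfspace h hh.1)
      (fun h hh k hk => x.inter_nonempty h hh.1 k hk.1)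
    -- `g'` lies in all elements of `F`, and also on the side of `v` of those hyperplanes between
    -- `v` and `g` that have `x` on that side
    obtain ⟨g', hg'⟩ := hX.helly_halfspaces
      (S := F ∪ ({h | h ∈ x.halfspaces} ∩ X.separators v g))
      (hfin.union ((hX.finite_separators v g).subset inter_subset_right))
      (hne.mono subset_union_left)
      (by rintro h (hh | hh); exacts [x.isHalfspace h hh.1, x.isHalfspace h hh.1])
      (by
        rintro h hh k hk
        refine x.inter_nonempty h ?_ k ?_
        · rcases hh with hh | hh <;> exact hh.1
        · rcases hk with hk | hk <;> exact hk.1)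
    obtain ⟨m, hm1, hm2, hm3⟩ := hX.exists_median g g' v
    refine ⟨m, (hX.roller_eq (y := X.ofVertex m) fun h hh => ⟨x.isHalfspace h hh, ?_⟩).symm⟩
    have hh' := x.isHalfspace h hh
    by_cases hv : v ∈ h
    · by_cases hgh : g ∈ h
      · exact hX.mem_of_between hm3 hh' hv hgh
      · exact hX.mem_of_between hm2 hh' (hg' h (.inr ⟨hh, hh', hv, hgh⟩)) hv
    · exact hX.mem_of_between hm1 hh' (hg h ⟨hh, hv⟩) (hg' h (.inl ⟨hh, hv⟩))

/-! ### Gromov products -/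

theorem gromovProduct_comm (v : V) (x y : X.Roller) :
    X.gromovProduct v x y = X.gromovProduct v y x := by
  simp only [gromovProduct]
  congr 1
  ext h
  simp only [mem_ofPred_eq]
  tauto

theorem gromovProduct_eq_zero {v : V} {x y : X.Roller} : X.gromovProduct v x y = 0 ↔
    ∀ h, h ∈ x.halfspaces → h ∈ y.halfspaces → v ∈ h := by
  rw [gromovProduct, Set.encard_eq_zero, Set.eq_empty_iff_forall_notMem]
  simp only [mem_ofPred_eq, not_and, not_not]

theorem IsCAT0.gromovProduct_self (hX : X.IsCAT0) (v : V) {x : X.Roller} (hx : x ∈ X.boundary) :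
    X.gromovProduct v x x = ⊤ := by
  by_contra hcon
  rw [gromovProduct, Set.encard_eq_top_iff, Set.not_infinite] at hcon
  exact hx (hX.exists_eq_ofVertex (v := v) (by simpa using hcon))

/-- The number of halfspaces that contain `x` and `u` but not `v`. -/
noncomputable def towards (X : CubicalComplex V) (u v : V) (x : X.Roller) : ℕ∞ :=
  (X.separators u v ∩ x.halfspaces).encard

theorem IsCAT0.towards_le (hX : X.IsCAT0) (u v : V) (x : X.Roller) :
    X.towards u v x ≤ X.graph.dist u v := by
  rw [← hX.encard_separators]
  exact Set.encard_le_encard inter_subset_left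

theorem IsCAT0.towards_eq_dist (hX : X.IsCAT0) {u v : V} {x : X.Roller}
    (h : ∀ k ∈ X.separators u v, k ∈ x.halfspaces) : X.towards u v x = X.graph.dist u v := by
  rw [towards, inter_eq_left.2 h, hX.encard_separators]

theorem gromovProduct_split (u v : V) (x y : X.Roller) :
    X.gromovProduct v x y = (X.separators u v ∩ (x.halfspaces ∩ y.halfspaces)).encard +
      {h | h ∈ x.halfspaces ∧ h ∈ y.halfspaces ∧ v ∉ h ∧ u ∉ h}.encard := by
  rw [gromovProduct, ← Set.encard_union_eq]
  · congr 1
    ext h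
    have := x.isHalfspace h
    simp only [separators, mem_ofPred_eq, mem_union, mem_inter_iff]
    tauto
  · rw [Set.disjoint_left]
    rintro h ⟨h1, -⟩ h2
    exact h2.2.2.2 h1.2.1

theorem IsCAT0.encard_separators_compl (hX : X.IsCAT0) (u v : V) (x y : X.Roller) :
    (X.separators v u ∩ (x.halfspaces ∩ y.halfspaces)).encard =
      (X.separators u v \ (x.halfspaces ∪ y.halfspaces)).encard := by
  rw [← Function.Injective.encard_image (f := compl) compl_injective]
  congr 1
  ext h
  simp only [mem_image, separators, mem_inter_iff, mem_ofPred_eq, Set.mem_sdiff, mem_union]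
  constructor
  · rintro ⟨k, ⟨⟨h1, h2, h3⟩, h4, h5⟩, rfl⟩
    rw [hX.compl_mem_iff _ h1, hX.compl_mem_iff _ h1]
    exact ⟨⟨hX.isHalfspace_compl h1, h3, by simpa using h2⟩, by tauto⟩
  · rintro ⟨⟨h1, h2, h3⟩, h4⟩
    refine ⟨hᶜ, ⟨⟨hX.isHalfspace_compl h1, h3, by simpa using h2⟩, ?_⟩, compl_compl h⟩
    rw [hX.compl_mem_iff _ h1, hX.compl_mem_iff _ h1]
    tauto

/-- Change of the basepoint of a Gromov product. Each hyperplane between `u` and `v` contributes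
equally to both sides. -/
theorem IsCAT0.gromovProduct_add_dist (hX : X.IsCAT0) (u v : V) (x y : X.Roller) :
    X.gromovProduct v x y + X.graph.dist u v =
      X.gromovProduct u x y + X.towards u v x + X.towards u v y := by
  have hsymm : {h | h ∈ x.halfspaces ∧ h ∈ y.halfspaces ∧ v ∉ h ∧ u ∉ h} =
      {h | h ∈ x.halfspaces ∧ h ∈ y.halfspaces ∧ u ∉ h ∧ v ∉ h} := by
    ext h; simp only [mem_ofPred_eq]; tauto
  have h1 : (X.separators u v).encard =
      (X.separators u v ∩ (x.halfspaces ∪ y.halfspaces)).encard +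
        (X.separators u v \ (x.halfspaces ∪ y.halfspaces)).encard := by
    rw [add_comm, Set.encard_sdiff_add_encard_inter]
  have h2 : X.towards u v x + X.towards u v y =
      (X.separators u v ∩ (x.halfspaces ∪ y.halfspaces)).encard +
        (X.separators u v ∩ (x.halfspaces ∩ y.halfspaces)).encard := by
    rw [towards, towards, ← Set.encard_union_add_encard_inter, inter_union_distrib_left,
      ← inter_inter_distrib_left]
  rw [gromovProduct_split u v, gromovProduct_split v u, hsymm, ← hX.encard_separators,
    hX.encard_separators_compl u v, add_assoc _ (X.towards u v x), h2, h1]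
  ring

theorem gromovProduct_ofVertex_left (u v : V) (x : X.Roller) :
    X.gromovProduct v (X.ofVertex u) x = X.towards u v x := by
  rw [gromovProduct, towards]
  congr 1
  ext h
  simp only [mem_ofVertex, separators, mem_ofPred_eq, mem_inter_iff]
  tauto

/-! ### Opposite points -/

theorem mem_interval {x y z : X.Roller} : z ∈ X.interval x y ↔
    ∀ h, h ∈ x.halfspaces → h ∈ y.halfspaces → h ∈ z.halfspaces := Iff.rfl

/-- Opposite triples in terms of the halfspaces that do not contain the median. -/
theorem IsCAT0.oppositeAt_iff (hX : X.IsCAT0) {x y z : X.Roller} {v : V} :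
    X.OppositeAt x y z v ↔
      (∀ h ∈ x.halfspaces, ∀ k ∈ y.halfspaces, v ∉ h → v ∉ k → ¬ (h ∩ k).Nonempty) ∧
        X.gromovProduct v x z = 0 ∧ X.gromovProduct v y z = 0 := by
  have hmed : X.IsMedian x y z (X.ofVertex v) ↔ X.gromovProduct v x y = 0 ∧
      X.gromovProduct v x z = 0 ∧ X.gromovProduct v y z = 0 := by
    simp only [gromovProduct_eq_zero]
    constructor
    · rintro ⟨h1, h2, h3⟩
      exact ⟨fun h ha hb => (h1 h ha hb).2, fun h ha hb => (h3 h hb ha).2,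
        fun h ha hb => (h2 h ha hb).2⟩
    · rintro ⟨h1, h2, h3⟩
      exact ⟨fun h ha hb => ⟨x.isHalfspace h ha, h1 h ha hb⟩,
        fun h ha hb => ⟨y.isHalfspace h ha, h3 h ha hb⟩,
        fun h ha hb => ⟨x.isHalfspace h hb, h2 h hb ha⟩⟩
  rw [OppositeAt, hmed]
  constructor
  · rintro ⟨⟨h1, h2, h3⟩, hI⟩
    refine ⟨?_, h2, h3⟩
    rintro h hh k hk hvh hvk ⟨u, hu, hu'⟩
    rw [gromovProduct_eq_zero] at h1
    have hh' := x.isHalfspace h hh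
    have hk' := y.isHalfspace k hk
    -- the median of `x`, `y` and `u` lies beyond both `h` and `k`
    obtain ⟨m, hm1, hm2, hm3⟩ := hX.exists_isMedian x y (X.ofVertex u)
    have hmh : h ∈ m.halfspaces := hm3 h ⟨hh', hu⟩ hh
    have hmk : k ∈ m.halfspaces := hm2 k hk ⟨hk', hu'⟩
    rw [hI] at hm1
    rcases hm1 with hm | hm
    · refine (hX.compl_mem_iff m hk').1 (hm kᶜ ?_ ⟨hX.isHalfspace_compl hk', hvk⟩) hmk
      exact (hX.compl_mem_iff x hk').2 fun hxk => hvk (h1 k hxk hk)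
    · refine (hX.compl_mem_iff m hh').1 (hm hᶜ ⟨hX.isHalfspace_compl hh', hvh⟩ ?_) hmh
      exact (hX.compl_mem_iff y hh').2 fun hyh => hvh (h1 h hh hyh)
  · rintro ⟨h1, h2, h3⟩
    have h0 : X.gromovProduct v x y = 0 := by
      rw [gromovProduct_eq_zero]
      intro h ha hb
      by_contra hv
      exact h1 h ha h hb hv hv (x.inter_nonempty _ ha _ ha)
    refine ⟨⟨h0, h2, h3⟩, Subset.antisymm ?_ ?_⟩
    · intro u hu
      by_contra hcon
      simp only [mem_union, mem_interval, not_or, not_forall] at hcon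
      obtain ⟨⟨h, hxh, hvh, huh⟩, k, hvk, hyk, huk⟩ := hcon
      have hh' := x.isHalfspace h hxh
      have hk' := y.isHalfspace k hyk
      have hyh : h ∉ y.halfspaces := fun hyh => huh (hu h hxh hyh)
      have hxk : k ∉ x.halfspaces := fun hxk => huk (hu k hxk hyk)
      rw [← hX.compl_mem_iff _ hk'] at hxk huk
      rw [← hX.compl_mem_iff _ hh'] at hyh huh
      exact h1 _ hxk _ hyh (by simpa using hvk.2) (by simpa using hvh.2)
        (u.inter_nonempty _ huk _ huh)
    · rw [gromovProduct_eq_zero] at h0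
      rintro u (hu | hu) h hxh hyh
      · exact hu h hxh ⟨x.isHalfspace h hxh, h0 h hxh hyh⟩
      · exact hu h ⟨x.isHalfspace h hxh, h0 h hxh hyh⟩ hyh

theorem OppositeAt.gromovProduct_eq_zero {x y z : X.Roller} {v : V}
    (h : X.OppositeAt x y z v) : X.gromovProduct v x y = 0 := by
  rw [CubicalComplex.gromovProduct_eq_zero]
  exact fun k hx hy => (h.1.1 k hx hy).2

/-- In an opposite triple, one of the two opposite points sees no hyperplane in common with a given
point. -/
theorem IsCAT0.gromovProduct_eq_zero_or (hX : X.IsCAT0) {x y z : X.Roller} {v : V}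
    (h : X.OppositeAt x y z v) (w : X.Roller) :
    X.gromovProduct v x w = 0 ∨ X.gromovProduct v y w = 0 := by
  by_contra! hcon
  simp only [ne_eq, gromovProduct_eq_zero, not_forall] at hcon
  obtain ⟨⟨h1, h2, h3, h4⟩, k1, k2, k3, k4⟩ := hcon
  exact (hX.oppositeAt_iff.1 h).1 h1 h2 k1 k2 h4 k4 (w.inter_nonempty _ h3 _ k3)

/-- If `v` is the median of an opposite triple `x, y, z`, then every vertex `u` is on the far side
of `v` for one of the points `x` and `y`. -/
theorem IsCAT0.exists_separators_subset (hX : X.IsCAT0) {x y z : X.Roller} {v : V}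
    (h : X.OppositeAt x y z v) (u : V) :
    (∀ k ∈ X.separators v u, k ∈ x.halfspaces) ∨ ∀ k ∈ X.separators v u, k ∈ y.halfspaces := by
  by_contra! hcon
  obtain ⟨⟨h1, ⟨h2, h3, h4⟩, h5⟩, k1, ⟨k2, k3, k4⟩, k5⟩ := hcon
  rw [← hX.compl_mem_iff _ h2] at h5
  rw [← hX.compl_mem_iff _ k2] at k5
  exact (hX.oppositeAt_iff.1 h).1 _ h5 _ k5 (by simpa using h3) (by simpa using k3) ⟨u, h4, k4⟩

/-! ### Regular points -/

/-- `h` is a strongly separated chain of halfspaces that converges to `x`. -/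
structure IsRegularChain (X : CubicalComplex V) (x : X.Roller) (h : ℕ → Set V) : Prop where
  mem : ∀ n, h n ∈ x.halfspaces
  ssubset : ∀ n, h (n + 1) ⊂ h n
  sep : ∀ n, X.StronglySeparated (h n)ᶜ (h (n + 1))

namespace IsRegularChain

variable {x : X.Roller} {h : ℕ → Set V}

theorem strictAnti (hh : X.IsRegularChain x h) : StrictAnti h :=
  strictAnti_nat_of_succ_lt hh.ssubset

theorem subset (hh : X.IsRegularChain x h) {m n : ℕ} (hmn : m ≤ n) : h n ⊆ h m :=
  hh.strictAnti.antitone hmn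

/-- A chain of halfspaces leaves every vertex behind. -/
theorem exists_notMem (hX : X.IsCAT0) (hh : X.IsRegularChain x h) (v : V) :
    ∃ n, ∀ m, n ≤ m → v ∉ h m := by
  suffices hs : ∃ n, v ∉ h n by
    obtain ⟨n, hn⟩ := hs
    exact ⟨n, fun m hm hv => hn (hh.subset hm hv)⟩
  by_contra! hcon
  obtain ⟨q, hq, hq'⟩ := exists_of_ssubset (hh.ssubset 0)
  refine Set.infinite_of_injective_forall_mem (f := fun n => h (n + 1))
    (fun a b hab => Nat.succ_injective (hh.strictAnti.injective hab)) (fun n => ?_)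
    (hX.finite_separators v q)
  exact ⟨x.isHalfspace _ (hh.mem _), hcon _, fun hqn => hq' (hh.subset (by omega) hqn)⟩

/-- The conditions are those for `k` to be transverse to both `(h n)ᶜ` and `h (n + 1)`, without the
ones that follow from `h (n + 1) ⊆ h n`. -/
theorem not_transverse (hh : X.IsRegularChain x h) {k : Set V} (hk : X.IsHalfspace k) (n : ℕ)
    (h1 : (k ∩ h (n + 1)).Nonempty) (h2 : (kᶜ ∩ h (n + 1)).Nonempty)
    (h3 : (k ∩ (h n)ᶜ).Nonempty) (h4 : (kᶜ ∩ (h n)ᶜ).Nonempty) : False := by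
  have hsub := hh.subset (Nat.le_succ n)
  have hsub' := compl_subset_compl.2 hsub
  refine (hh.sep n).2.2.2 k hk ⟨⟨h3, h4, ?_, ?_⟩, h1, h2, h3.mono ?_, h4.mono ?_⟩
  · rw [compl_compl]; exact h1.mono (inter_subset_inter_right _ hsub)
  · rw [compl_compl]; exact h2.mono (inter_subset_inter_right _ hsub)
  · exact inter_subset_inter_right _ hsub'
  · exact inter_subset_inter_right _ hsub'

/-- The chain is a neighbourhood basis of `x`. -/
theorem exists_subset (hX : X.IsCAT0) (hh : X.IsRegularChain x h) {k : Set V}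
    (hk : k ∈ x.halfspaces) : ∃ n, h n ⊆ k := by
  by_contra! hcon
  have hk' := x.isHalfspace k hk
  obtain ⟨p, hp⟩ := hk'.nonempty
  obtain ⟨q, hq⟩ := (hX.isHalfspace_compl hk').nonempty
  obtain ⟨n1, hn1⟩ := hh.exists_notMem hX p
  obtain ⟨n2, hn2⟩ := hh.exists_notMem hX q
  refine hh.not_transverse hk' (n1 + n2) (x.inter_nonempty _ hk _ (hh.mem _)) ?_
    ⟨p, hp, hn1 _ (by omega)⟩ ⟨q, hq, hn2 _ (by omega)⟩
  obtain ⟨a, ha, ha'⟩ := Set.not_subset.1 (hcon (n1 + n2 + 1))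
  exact ⟨a, ha', ha⟩

/-- A halfspace that separates a vertex from `x` and from another point, where neither the vertex
nor the other point is in the `n`-th element of the chain, contains the next element. -/
theorem subset_of_mem (hX : X.IsCAT0) (hh : X.IsRegularChain x h) {k : Set V} {n : ℕ} {y : X.Roller}
    {p : V} (hy : h n ∉ y.halfspaces) (hp : p ∉ h n) (hkx : k ∈ x.halfspaces)
    (hky : k ∈ y.halfspaces) (hkp : p ∉ k) : h (n + 1) ⊆ k := by
  by_contra hcon
  obtain ⟨a, ha, ha'⟩ := Set.not_subset.1 hcon
  exact hh.not_transverse (x.isHalfspace k hkx) n (x.inter_nonempty _ hkx _ (hh.mem _)) ⟨a, ha', ha⟩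
    (y.inter_nonempty _ hky _ ((hX.compl_mem_iff y (x.isHalfspace _ (hh.mem n))).2 hy))
    ⟨p, hkp, hp⟩

/-- The Gromov product of `x` with points outside an element of its chain is bounded. -/
theorem exists_gromovProduct_le (hX : X.IsCAT0) (hh : X.IsRegularChain x h) (p : V) (n : ℕ) :
    ∃ N : ℕ, ∀ y : X.Roller, h n ∉ y.halfspaces → X.gromovProduct p x y ≤ N := by
  obtain ⟨n0, hn0⟩ := hh.exists_notMem hX p
  obtain ⟨q, hq⟩ := (x.isHalfspace _ (hh.mem (n0 + n + 1))).nonempty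
  refine ⟨X.graph.dist q p, fun y hy => ?_⟩
  rw [← hX.encard_separators]
  refine Set.encard_le_encard ?_
  rintro k ⟨hkx, hky, hkp⟩
  have hy' : h (n0 + n) ∉ y.halfspaces := fun hm =>
    hy (hX.mem_of_subset hm (x.isHalfspace _ (hh.mem n)) (hh.subset (by omega)))
  exact ⟨x.isHalfspace k hkx,
    hh.subset_of_mem hX hy' (hn0 _ (by omega)) hkx hky hkp hq, hkp⟩

end IsRegularChain

theorem exists_isRegularChain {x : X.Roller} (hx : x ∈ X.regularBoundary) :
    ∃ h, X.IsRegularChain x h := by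
  obtain ⟨-, h, h1, h2, h3⟩ := hx
  exact ⟨h, h1, h2, h3⟩

theorem IsCAT0.gromovProduct_ne_top (hX : X.IsCAT0) (v : V) {x y : X.Roller}
    (hx : x ∈ X.regularBoundary) (hxy : x ≠ y) : X.gromovProduct v x y ≠ ⊤ := by
  obtain ⟨h, hh⟩ := exists_isRegularChain hx
  have : ∃ n, h n ∉ y.halfspaces := by
    by_contra! hcon
    refine hxy (hX.roller_eq fun k hk => ?_)
    obtain ⟨n, hn⟩ := hh.exists_subset hX hk
    exact hX.mem_of_subset (hcon n) (x.isHalfspace k hk) hn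
  obtain ⟨n, hn⟩ := this
  obtain ⟨N, hN⟩ := hh.exists_gromovProduct_le hX v n
  exact ne_top_of_le_ne_top (ENat.natCast_ne_top N) (hN y hn)

/-- The median of three distinct regular points is a vertex. -/
theorem IsCAT0.exists_isMedian_ofVertex (hX : X.IsCAT0) {x y z : X.Roller}
    (hx : x ∈ X.regularBoundary) (hy : y ∈ X.regularBoundary) (hz : z ∈ X.regularBoundary)
    (hxy : x ≠ y) (hyz : y ≠ z) (hzx : z ≠ x) : ∃ v, X.IsMedian x y z (X.ofVertex v) := by
  obtain ⟨v⟩ := hX.connected.nonempty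
  obtain ⟨m, hm⟩ := hX.exists_isMedian x y z
  have hfin : ∀ {a b : X.Roller}, a ∈ X.regularBoundary → a ≠ b →
      {h | h ∈ a.halfspaces ∧ h ∈ b.halfspaces ∧ v ∉ h}.Finite := fun ha hab => by
    rw [← Set.encard_ne_top_iff]
    exact hX.gromovProduct_ne_top v ha hab
  obtain ⟨u, rfl⟩ := hX.exists_eq_ofVertex (x := m) (v := v)
    (((hfin hx hxy).union ((hfin hy hyz).union (hfin hz hzx))).subset (by
      rintro h ⟨hh, hv⟩
      have := (hX.mem_isMedian_iff hm (m.isHalfspace h hh)).1 hh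
      simp only [mem_union, mem_ofPred_eq]
      tauto))
  exact ⟨u, hm⟩

/-- An ample set contains a point `a` that looks from `v` like a given regular point `x`: a
halfspace that contains `a` and is maximal among those that avoid `v` also contains `x`. Any point
deep inside a strongly separated chain for `x` will do, since such a halfspace that contains `a` but
not `x` would be transverse to two consecutive elements of the chain. -/
theorem IsCAT0.exists_mem_ample (hX : X.IsCAT0) {A : Set X.Roller} (hA : X.Ample A) {x : X.Roller}
    (hx : x ∈ X.regularBoundary) (v : V) : ∃ a ∈ A, ∀ k, X.IsMaxAvoiding v k →
      k ∈ a.halfspaces → k ∈ x.halfspaces := by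
  obtain ⟨h, hh⟩ := exists_isRegularChain hx
  obtain ⟨n, hn⟩ := hh.exists_notMem hX v
  obtain ⟨a, ha, hS⟩ := hA {h (n + 2)} (by simp)
    (by simpa using x.isHalfspace _ (hh.mem (n + 2))) (by
      simp only [Finset.mem_singleton]
      rintro _ rfl _ rfl hne
      exact absurd rfl hne)
  refine ⟨a, ha, fun k hk hka => ?_⟩
  have ha' := hS _ (Finset.mem_singleton_self _)
  by_contra hkx
  refine hh.not_transverse hk.1 (n + 1) (a.inter_nonempty _ hka _ ha')
    (x.inter_nonempty _ ((hX.compl_mem_iff x hk.1).2 hkx) _ (hh.mem _)) ?_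
    ⟨v, hk.2.1, hn _ (by omega)⟩
  by_contra hemp
  rw [Set.not_nonempty_iff_eq_empty, ← Set.disjoint_iff_inter_eq_empty,
    Set.disjoint_compl_right_iff_subset] at hemp
  have := hk.2.2 (h n) (x.isHalfspace _ (hh.mem n)) (hn n le_rfl)
    (hemp.trans (hh.subset (by omega)))
  exact (hh.ssubset n).2 (this ▸ hemp)

/-- Every median of an opposite triple of regular points is the median of an opposite triple in a
given ample set. -/
theorem IsCAT0.exists_oppositeAt_of_ample (hX : X.IsCAT0) {A : Set X.Roller} (hA : X.Ample A)
    {v : V} (hv : v ∈ X.orMedians) : ∃ x ∈ A, ∃ y ∈ A, ∃ z ∈ A, X.OppositeAt x y z v := by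
  obtain ⟨x, hx, y, hy, z, hz, hop⟩ := hv
  obtain ⟨a, ha, hax⟩ := hX.exists_mem_ample hA hx v
  obtain ⟨b, hb, hby⟩ := hX.exists_mem_ample hA hy v
  obtain ⟨c, hc, hcz⟩ := hX.exists_mem_ample hA hz v
  refine ⟨a, ha, b, hb, c, hc, ?_⟩
  rw [hX.oppositeAt_iff] at hop ⊢
  obtain ⟨h1, h2, h3⟩ := hop
  rw [gromovProduct_eq_zero] at h2 h3
  refine ⟨?_, ?_, ?_⟩
  · rintro h hh k hk hvh hvk hhk
    obtain ⟨h', hmax, hsub⟩ := hX.exists_isMaxAvoiding (a.isHalfspace h hh) hvh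
    obtain ⟨k', hmax', hsub'⟩ := hX.exists_isMaxAvoiding (b.isHalfspace k hk) hvk
    exact h1 h' (hax h' hmax (hX.mem_of_subset hh hmax.1 hsub)) k'
      (hby k' hmax' (hX.mem_of_subset hk hmax'.1 hsub')) hmax.2.1 hmax'.2.1
      (hhk.mono (inter_subset_inter hsub hsub'))
  · rw [gromovProduct_eq_zero]
    intro h hh hh'
    by_contra hvh
    obtain ⟨k, hmax, hsub⟩ := hX.exists_isMaxAvoiding (a.isHalfspace h hh) hvh
    exact hmax.2.1 (h2 k (hax k hmax (hX.mem_of_subset hh hmax.1 hsub))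
      (hcz k hmax (hX.mem_of_subset hh' hmax.1 hsub)))
  · rw [gromovProduct_eq_zero]
    intro h hh hh'
    by_contra hvh
    obtain ⟨k, hmax, hsub⟩ := hX.exists_isMaxAvoiding (b.isHalfspace h hh) hvh
    exact hmax.2.1 (h3 k (hby k hmax (hX.mem_of_subset hh hmax.1 hsub))
      (hcz k hmax (hX.mem_of_subset hh' hmax.1 hsub)))

end RollerPoints

/-! ### Cross ratios -/

section CrossRatio

variable {X : CubicalComplex V} {Y : CubicalComplex W}

/-- The cross ratio does not depend on the basepoint. -/
theorem IsCAT0.crossRatio_basepoint (hX : X.IsCAT0) (u v : V) (x y z w : X.Roller) :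
    X.gromovProduct v x z + X.gromovProduct v y w +
        (X.gromovProduct u x w + X.gromovProduct u y z) =
      X.gromovProduct v x w + X.gromovProduct v y z +
        (X.gromovProduct u x z + X.gromovProduct u y w) := by
  have h1 := hX.gromovProduct_add_dist u v x z
  have h2 := hX.gromovProduct_add_dist u v y w
  have h3 := hX.gromovProduct_add_dist u v x w
  have h4 := hX.gromovProduct_add_dist u v y z
  have hd : (X.graph.dist u v + X.graph.dist u v : ℕ∞) ≠ ⊤ := by
    exact_mod_cast ENat.natCast_ne_top (X.graph.dist u v + X.graph.dist u v)
  refine (ENat.add_left_injective_of_ne_top hd) ?_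
  calc _ = (X.gromovProduct v x z + X.graph.dist u v) +
        (X.gromovProduct v y w + X.graph.dist u v) +
          (X.gromovProduct u x w + X.gromovProduct u y z) := by ring
    _ = (X.gromovProduct v x w + X.graph.dist u v) +
        (X.gromovProduct v y z + X.graph.dist u v) +
          (X.gromovProduct u x z + X.gromovProduct u y w) := by rw [h1, h2, h3, h4]; ring
    _ = _ := by ring

variable {A : Set X.Roller} {B : Set Y.Roller}

/-- A Möbius bijection preserves the differences of sums of Gromov products. The two sides are both
infinite if an infinite Gromov product is involved. -/
theorem IsMoebius.gromovProduct_add (hX : X.IsCAT0) (hY : Y.IsCAT0)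
    (hA : A ⊆ X.regularBoundary) (hB : B ⊆ Y.regularBoundary) {f : A → B}
    (hinj : Function.Injective f) (hf : X.IsMoebius Y f) (v : V) (v' : W) (x y z w : A) :
    X.gromovProduct v x z + X.gromovProduct v y w +
        (Y.gromovProduct v' (f x) (f w) + Y.gromovProduct v' (f y) (f z)) =
      X.gromovProduct v x w + X.gromovProduct v y z +
        (Y.gromovProduct v' (f x) (f z) + Y.gromovProduct v' (f y) (f w)) := by
  have hself : ∀ a : A, X.gromovProduct v a a = ⊤ := fun a =>
    hX.gromovProduct_self v (hA a.2).1
  have hself' : ∀ b : B, Y.gromovProduct v' b b = ⊤ := fun b =>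
    hY.gromovProduct_self v' (hB b.2).1
  by_cases hxz : x = z
  · simp [hxz, hself, hself']
  by_cases hyw : y = w
  · simp [hyw, hself, hself']
  by_cases hxw : x = w
  · simp [hxw, hself, hself']
  by_cases hyz : y = z
  · simp [hyz, hself, hself']
  have hfin : ∀ (u : V) {a b : A}, a ≠ b → X.gromovProduct u a b ≠ ⊤ := fun u a b hab =>
    hX.gromovProduct_ne_top u (hA a.2) (Subtype.coe_ne_coe.2 hab)
  have hfin' : ∀ (u : W) {a b : A}, a ≠ b → Y.gromovProduct u (f a) (f b) ≠ ⊤ := fun u a b hab =>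
    hY.gromovProduct_ne_top u (hB (f a).2) (Subtype.coe_ne_coe.2 (hinj.ne hab))
  obtain ⟨v₀, v₀', h⟩ := hf
  have hfin2 : ∀ (u : V) {a b c d : A}, a ≠ b → c ≠ d →
      ∃ n : ℕ, (n : ℕ∞) = X.gromovProduct u a b + X.gromovProduct u c d := fun u a b c d hab hcd =>
    ENat.ne_top_iff_exists.1 (WithTop.add_ne_top.2 ⟨hfin u hab, hfin u hcd⟩)
  have hfin2' : ∀ (u : W) {a b c d : A}, a ≠ b → c ≠ d →
      ∃ n : ℕ, (n : ℕ∞) = Y.gromovProduct u (f a) (f b) + Y.gromovProduct u (f c) (f d) :=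
    fun u a b c d hab hcd =>
      ENat.ne_top_iff_exists.1 (WithTop.add_ne_top.2 ⟨hfin' u hab, hfin' u hcd⟩)
  have e1 := hX.crossRatio_basepoint v₀ v x y z w
  have e2 := hY.crossRatio_basepoint v₀' v' (f x) (f y) (f z) (f w)
  obtain ⟨b, hb⟩ := hfin2 v hxz hyw
  obtain ⟨c, hc⟩ := hfin2 v hxw hyz
  obtain ⟨b₀, hb₀⟩ := hfin2 v₀ hxz hyw
  obtain ⟨c₀, hc₀⟩ := hfin2 v₀ hxw hyz
  obtain ⟨b', hb'⟩ := hfin2' v' hxz hyw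
  obtain ⟨c', hc'⟩ := hfin2' v' hxw hyz
  obtain ⟨b₀', hb₀'⟩ := hfin2' v₀' hxz hyw
  obtain ⟨c₀', hc₀'⟩ := hfin2' v₀' hxw hyz
  have h0 := (h x y z w ⟨fun h => ?_, fun h => ?_, fun h => ?_⟩).2
  · rw [crossRatio, crossRatio, ← hb₀, ← hc₀, ← hb₀', ← hc₀'] at h0
    have h0' : (b₀' : ℝ) - c₀' = b₀ - c₀ := by
      have hcast : ∀ n : ℕ, (((n : ℕ∞) : ENNReal) : EReal) = ((n : ℝ) : EReal) := fun n => by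
        simp only [ENat.toENNReal_coe, EReal.coe_natCast]
        rfl
      rw [hcast, hcast, hcast, hcast] at h0
      exact_mod_cast h0
    have h0'' : b₀' + c₀ = b₀ + c₀' := by
      have : (b₀' : ℝ) + c₀ = b₀ + c₀' := by linarith
      exact_mod_cast this
    rw [← hb, ← hc, ← hb₀, ← hc₀] at e1
    rw [← hb', ← hc', ← hb₀', ← hc₀'] at e2
    rw [← hb, ← hc, ← hb', ← hc']
    norm_cast at e1 e2 ⊢
    omega
  · exact ENat.natCast_ne_top _ (hb₀.trans h.2)
  · exact ENat.natCast_ne_top _ (hc₀.trans h.2)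
  · exact ENat.natCast_ne_top _ (hc₀.trans h.2)

/-- A bijection between ample sets of regular points of locally finite `CAT(0)` cube complexes that
preserves cross ratios. These conditions are symmetric in the two complexes. The cross ratios are
compared through sums of Gromov products, so that no subtraction is needed. -/
structure MoebiusEquiv (X : CubicalComplex V) (Y : CubicalComplex W) {A : Set X.Roller}
    {B : Set Y.Roller} (f : A ≃ B) : Prop where
  left : X.IsCAT0
  right : Y.IsCAT0
  left_finite : X.LocallyFinite
  right_finite : Y.LocallyFinite
  left_regular : A ⊆ X.regularBoundary
  right_regular : B ⊆ Y.regularBoundary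
  left_ample : X.Ample A
  right_ample : Y.Ample B
  gromovProduct_add : ∀ (v : V) (v' : W) (x y z w : A),
    X.gromovProduct v x z + X.gromovProduct v y w +
        (Y.gromovProduct v' (f x) (f w) + Y.gromovProduct v' (f y) (f z)) =
      X.gromovProduct v x w + X.gromovProduct v y z +
        (Y.gromovProduct v' (f x) (f z) + Y.gromovProduct v' (f y) (f w))

/-- `v` and `v'` are the medians of an opposite triple and of its image. -/
def Corresponds (X : CubicalComplex V) (Y : CubicalComplex W)
    {A : Set X.Roller} {B : Set Y.Roller} (f : A ≃ B) (v : V) (v' : W) : Prop :=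
  ∃ x y z : A, X.OppositeAt x y z v ∧ Y.OppositeAt (f x) (f y) (f z) v'

theorem Corresponds.symm {f : A ≃ B} {v : V} {v' : W} (h : X.Corresponds Y f v v') :
    Y.Corresponds X f.symm v' v := by
  obtain ⟨x, y, z, h1, h2⟩ := h
  exact ⟨f x, f y, f z, h2, by simpa using h1⟩

namespace MoebiusEquiv

variable {f : A ≃ B}

theorem symm (hf : X.MoebiusEquiv Y f) : Y.MoebiusEquiv X f.symm where
  left := hf.right
  right := hf.left
  left_finite := hf.right_finite
  right_finite := hf.left_finite
  left_regular := hf.right_regular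
  right_regular := hf.left_regular
  left_ample := hf.right_ample
  right_ample := hf.left_ample
  gromovProduct_add v v' x y z w := by
    have := hf.gromovProduct_add v' v (f.symm x) (f.symm y) (f.symm z) (f.symm w)
    simp only [Equiv.apply_symm_apply] at this
    rw [add_comm, ← this, add_comm]

theorem left_ne_of_gromovProduct (hf : X.MoebiusEquiv Y f) {v : V} {x y : A}
    (h : X.gromovProduct v x y = 0) : x ≠ y := by
  rintro rfl
  rw [hf.left.gromovProduct_self v (hf.left_regular x.2).1] at h
  exact ENat.top_ne_zero h

theorem left_pairwise_ne (hf : X.MoebiusEquiv Y f) {v : V} {x y z : A}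
    (h : X.OppositeAt x y z v) : x ≠ y ∧ y ≠ z ∧ z ≠ x := by
  have h' := (hf.left.oppositeAt_iff.1 h).2
  exact ⟨hf.left_ne_of_gromovProduct h.gromovProduct_eq_zero, hf.left_ne_of_gromovProduct h'.2,
    (hf.left_ne_of_gromovProduct h'.1).symm⟩

/-- Opposite triples are preserved. If the images of `x` and `y` were not opposite, then there would
be transverse halfspaces `h` and `k` between the median of the images and the images of `x` and `y`.
Ampleness provides a point in `h` and `k` that has no halfspace in common with the image of `z`, and
the cross ratios of this point contradict that `x` and `y` are opposite. -/
theorem exists_oppositeAt (hf : X.MoebiusEquiv Y f) {x y z : A} {v : V}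
    (hop : X.OppositeAt x y z v) : ∃ v', Y.OppositeAt (f x) (f y) (f z) v' := by
  have hY := hf.right
  obtain ⟨hxy, hyz, hzx⟩ := hf.left_pairwise_ne hop
  have hne : ∀ {a b : A}, a ≠ b → (f a : Y.Roller) ≠ f b := fun hab =>
    Subtype.coe_ne_coe.2 (f.injective.ne hab)
  obtain ⟨v', hv'⟩ := hY.exists_isMedian_ofVertex (hf.right_regular (f x).2)
    (hf.right_regular (f y).2) (hf.right_regular (f z).2) (hne hxy) (hne hyz) (hne hzx)
  have hxy0 : Y.gromovProduct v' (f x) (f y) = 0 := gromovProduct_eq_zero.2 fun k h1 h2 =>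
    (hv'.1 k h1 h2).2
  have hyz0 : Y.gromovProduct v' (f y) (f z) = 0 := gromovProduct_eq_zero.2 fun k h1 h2 =>
    (hv'.2.1 k h1 h2).2
  have hxz0 : Y.gromovProduct v' (f x) (f z) = 0 := gromovProduct_eq_zero.2 fun k h1 h2 =>
    (hv'.2.2 k h2 h1).2
  refine ⟨v', hY.oppositeAt_iff.2 ⟨?_, hxz0, hyz0⟩⟩
  intro h hh k hk hvh hvk hhk
  have hh' := (f x : Y.Roller).isHalfspace h hh
  have hk' := (f y : Y.Roller).isHalfspace k hk
  have hxk : k ∉ (f x : Y.Roller).halfspaces := fun hxk =>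
    hvk (gromovProduct_eq_zero.1 hxy0 k hxk hk)
  have hyh : h ∉ (f y : Y.Roller).halfspaces := fun hyh =>
    hvh (gromovProduct_eq_zero.1 hxy0 h hh hyh)
  have hxk' := (hY.compl_mem_iff _ hk').2 hxk
  have hyh' := (hY.compl_mem_iff _ hh').2 hyh
  have hhkT : Transverse h k := ⟨hhk, (f y : Y.Roller).inter_nonempty _ hyh' _ hk,
    (f x : Y.Roller).inter_nonempty _ hh _ hxk', ⟨v', hvh, hvk⟩⟩
  have hTc : ∀ {a b : Set W}, Transverse a b → Transverse a bᶜ := fun ⟨h1, h2, h3, h4⟩ =>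
    ⟨h3, h4, by rwa [compl_compl], by rwa [compl_compl]⟩
  have hTs : ∀ {a b : Set W}, Transverse a b → Transverse b a := by
    rintro a b ⟨h1, h2, h3, h4⟩
    rw [inter_comm] at h1 h2 h3 h4
    exact ⟨h1, h3, h2, h4⟩
  -- the halfspaces next to `v'` that contain `f z` and cross both `h` and `k`
  set L : Set (Set W) := {l | Y.IsMaxAvoiding v' l ∧ l ∈ (f z : Y.Roller).halfspaces ∧
    Transverse h l ∧ Transverse k l}
  have hLfin : L.Finite := (hY.finite_isMaxAvoiding hf.right_finite v').subset fun l hl => hl.1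
  have hLT : ∀ l ∈ L, ∀ l' ∈ L, l ≠ l' → Transverse l l' := by
    rintro l ⟨hl1, hl2, -⟩ l' ⟨hl1', hl2', -⟩ hll
    refine transverse_of_not_subset ((f z : Y.Roller).inter_nonempty _ hl2 _ hl2') hl1.2.1
      hl1'.2.1 (fun hsub => ?_) (fun hsub => ?_)
    · exact hll (hl1.2.2 _ hl1'.1 hl1'.2.1 hsub).symm
    · exact hll (hl1'.2.2 _ hl1.1 hl1.2.1 hsub)
  have hSfin : (({h, k} : Set (Set W)) ∪ compl '' L).Finite :=
    (Set.toFinite _).union (hLfin.image _)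
  obtain ⟨w', hw', hS⟩ := hf.right_ample hSfin.toFinset ⟨h, by simp⟩ (by
      intro j hj
      rw [Set.Finite.mem_toFinset] at hj
      rcases hj with (rfl | rfl) | ⟨l, hl, rfl⟩
      exacts [hh', hk', hY.isHalfspace_compl hl.1.1]) (by
      intro i hi j hj hij
      rw [Set.Finite.mem_toFinset] at hi hj
      rcases hi with (rfl | rfl) | ⟨l, hl, rfl⟩ <;> rcases hj with (rfl | rfl) | ⟨l', hl', rfl⟩
      · exact absurd rfl hij
      · exact hhkT
      · exact hTc hl'.2.2.1
      · exact hTs hhkT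
      · exact absurd rfl hij
      · exact hTc hl'.2.2.2
      · exact hTs (hTc hl.2.2.1)
      · exact hTs (hTc hl.2.2.2)
      · exact hTc (hTs (hTc (hLT l' hl' l hl fun h => hij (by rw [h])))))
  obtain ⟨w, hw⟩ := f.surjective ⟨w', hw'⟩
  obtain rfl : (f w : Y.Roller) = w' := by rw [hw]
  have hwh : h ∈ (f w : Y.Roller).halfspaces := hS h (by simp)
  have hwk : k ∈ (f w : Y.Roller).halfspaces := hS k (by simp)
  have hzw0 : Y.gromovProduct v' (f z) (f w) = 0 := by
    rw [gromovProduct_eq_zero]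
    intro j hzj hwj
    by_contra hvj
    obtain ⟨l, hl, hjl⟩ := hY.exists_isMaxAvoiding ((f z : Y.Roller).isHalfspace j hzj) hvj
    have hzl := hY.mem_of_subset hzj hl.1 hjl
    have hwl := hY.mem_of_subset hwj hl.1 hjl
    have hxl := (hY.compl_mem_iff _ hl.1).2 fun hxl =>
      hl.2.1 (gromovProduct_eq_zero.1 hxz0 l hxl hzl)
    have hyl := (hY.compl_mem_iff _ hl.1).2 fun hyl =>
      hl.2.1 (gromovProduct_eq_zero.1 hyz0 l hyl hzl)
    have hzh := (hY.compl_mem_iff _ hh').2 fun hzh =>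
      hvh (gromovProduct_eq_zero.1 hxz0 h hh hzh)
    have hzk := (hY.compl_mem_iff _ hk').2 fun hzk =>
      hvk (gromovProduct_eq_zero.1 hyz0 k hk hzk)
    have hlL : l ∈ L := ⟨hl, hzl,
      ⟨(f w : Y.Roller).inter_nonempty _ hwh _ hwl, (f z : Y.Roller).inter_nonempty _ hzh _ hzl,
        (f x : Y.Roller).inter_nonempty _ hh _ hxl, ⟨v', hvh, hl.2.1⟩⟩,
      ⟨(f w : Y.Roller).inter_nonempty _ hwk _ hwl, (f z : Y.Roller).inter_nonempty _ hzk _ hzl,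
        (f y : Y.Roller).inter_nonempty _ hk _ hyl, ⟨v', hvk, hl.2.1⟩⟩⟩
    exact (hY.compl_mem_iff _ hl.1).1 (hS lᶜ (by
      rw [Set.Finite.mem_toFinset]; exact .inr ⟨l, hlL, rfl⟩)) hwl
  have hxw0 : Y.gromovProduct v' (f x) (f w) ≠ 0 := fun h0 =>
    hvh (gromovProduct_eq_zero.1 h0 h hh hwh)
  have hyw0 : Y.gromovProduct v' (f y) (f w) ≠ 0 := fun h0 =>
    hvk (gromovProduct_eq_zero.1 h0 k hk hwk)
  have hop' := hf.left.oppositeAt_iff.1 hop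
  have e1 := hf.gromovProduct_add v v' z x y w
  have e2 := hf.gromovProduct_add v v' z y x w
  rw [gromovProduct_comm (X := X) v z y, gromovProduct_comm (X := Y) v' (f z) (f y), hop'.2.2,
    hzw0, hop.gromovProduct_eq_zero, hxy0, hyz0] at e1
  rw [gromovProduct_comm (X := X) v z x, gromovProduct_comm (X := Y) v' (f z) (f x),
    gromovProduct_comm (X := X) v y x, gromovProduct_comm (X := Y) v' (f y) (f x), hop'.2.1,
    hzw0, hop.gromovProduct_eq_zero, hxy0, hxz0] at e2
  simp only [zero_add, add_zero] at e1 e2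
  rcases hf.left.gromovProduct_eq_zero_or hop w with h0 | h0
  · rw [h0] at e1
    exact hxw0 (add_eq_zero.1 e1.symm).2
  · rw [h0] at e2
    exact hyw0 (add_eq_zero.1 e2.symm).2

/-- Gromov products based at corresponding vertices agree. -/
theorem gromovProduct_eq (hf : X.MoebiusEquiv Y f) {v : V} {v' : W} (h : X.Corresponds Y f v v')
    (g w : A) : X.gromovProduct v g w = Y.gromovProduct v' (f g) (f w) := by
  obtain ⟨x, y, z, hop, hop'⟩ := h
  have h1 := (hf.left.oppositeAt_iff.1 hop).2
  have h2 := (hf.right.oppositeAt_iff.1 hop').2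
  have hxy := hop.gromovProduct_eq_zero
  have hxy' := hop'.gromovProduct_eq_zero
  have hdiff : ∀ w : A, X.gromovProduct v y w + Y.gromovProduct v' (f x) (f w) =
      X.gromovProduct v x w + Y.gromovProduct v' (f y) (f w) := by
    intro w
    have := hf.gromovProduct_add v v' x y z w
    simpa [h1, h2] using this
  have hboth : ∀ w : A, X.gromovProduct v x w = Y.gromovProduct v' (f x) (f w) ∧
      X.gromovProduct v y w = Y.gromovProduct v' (f y) (f w) := by
    intro w
    have h3 := hdiff w
    have h4 := hf.left.gromovProduct_eq_zero_or hop w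
    have h5 := hf.right.gromovProduct_eq_zero_or hop' (f w)
    rcases h4 with h4 | h4 <;> rcases h5 with h5 | h5 <;> rw [h4, h5] at h3 <;>
      simp only [zero_add, add_zero] at h3
    · rw [h4, h5, h3]; simp
    · obtain ⟨h6, h7⟩ := add_eq_zero.1 h3
      rw [h4, h5, h6, h7]; simp
    · obtain ⟨h6, h7⟩ := add_eq_zero.1 h3.symm
      rw [h4, h5, h6, h7]; simp
    · rw [h4, h5, h3]; simp
  by_cases hgy : g = y
  · rw [hgy]; exact (hboth w).2
  by_cases hwx : w = x
  · rw [hwx, gromovProduct_comm, gromovProduct_comm v']; exact (hboth g).1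
  have h3 := hf.gromovProduct_add v v' g x w y
  rw [hxy, hxy', gromovProduct_comm (X := X) v g y, gromovProduct_comm (X := Y) v' (f g) (f y),
    (hboth g).2, (hboth w).1, add_zero, add_zero] at h3
  have h4 : Y.gromovProduct v' (f y) (f g) + Y.gromovProduct v' (f x) (f w) ≠ ⊤ := by
    have hne : ∀ {a b : A}, a ≠ b → (f a : Y.Roller) ≠ f b := fun hab =>
      Subtype.coe_ne_coe.2 (f.injective.ne hab)
    exact WithTop.add_ne_top.2 ⟨hf.right.gromovProduct_ne_top _ (hf.right_regular (f y).2)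
      (hne (Ne.symm hgy)), hf.right.gromovProduct_ne_top _ (hf.right_regular (f x).2)
      (hne (Ne.symm hwx))⟩
  rw [add_comm (X.gromovProduct v g w)] at h3
  exact (ENat.add_right_injective_of_ne_top h4) h3

/-- Busemann functions are preserved: the number `2 * towards u v s - dist u v` is the value at `s`
of the Busemann function of `u` and `v`. It is determined by the Gromov products based at `u` and
`v` of `s` and two further points of `A`. -/
theorem towards_add_towards (hf : X.MoebiusEquiv Y f) {u v : V} {u' v' : W}
    (hu : X.Corresponds Y f u u') (hv : X.Corresponds Y f v v') (s : A) :
    X.towards u v s + X.towards u v s + Y.graph.dist u' v' =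
      Y.towards u' v' (f s) + Y.towards u' v' (f s) + X.graph.dist u v := by
  have hfinX : ∀ a : A, ∃ n : ℕ, (n : ℕ∞) = X.towards u v a := fun a =>
    ENat.ne_top_iff_exists.1
      (ne_top_of_le_ne_top (ENat.natCast_ne_top _) (hf.left.towards_le u v a))
  have hfinY : ∀ a : A, ∃ n : ℕ, (n : ℕ∞) = Y.towards u' v' (f a) := fun a =>
    ENat.ne_top_iff_exists.1
      (ne_top_of_le_ne_top (ENat.natCast_ne_top _) (hf.right.towards_le u' v' (f a)))
  choose T hT using hfinX
  choose T' hT' using hfinY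
  have hpair : ∀ {a b : A}, a ≠ b →
      T a + T b + Y.graph.dist u' v' = T' a + T' b + X.graph.dist u v := by
    intro a b hab
    have e1 := hf.left.gromovProduct_add_dist u v a b
    have e2 := hf.right.gromovProduct_add_dist u' v' (f a) (f b)
    rw [← hf.gromovProduct_eq hu, ← hf.gromovProduct_eq hv] at e2
    obtain ⟨n, hn⟩ := ENat.ne_top_iff_exists.1 (hf.left.gromovProduct_ne_top u
      (hf.left_regular a.2) (Subtype.coe_ne_coe.2 hab))
    obtain ⟨m, hm⟩ := ENat.ne_top_iff_exists.1 (hf.left.gromovProduct_ne_top v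
      (hf.left_regular a.2) (Subtype.coe_ne_coe.2 hab))
    rw [← hn, ← hm, ← hT, ← hT] at e1
    rw [← hn, ← hm, ← hT', ← hT'] at e2
    norm_cast at e1 e2
    omega
  have hthree : ∀ {a b : A}, s ≠ a → s ≠ b → a ≠ b →
      T s + T s + Y.graph.dist u' v' = T' s + T' s + X.graph.dist u v := by
    intro a b h1 h2 h3
    have e1 := hpair h1
    have e2 := hpair h2
    have e3 := hpair h3
    omega
  have hs : T s + T s + Y.graph.dist u' v' = T' s + T' s + X.graph.dist u v := by
    obtain ⟨x, y, z, hop, -⟩ := hu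
    obtain ⟨h1, h2, h3⟩ := hf.left_pairwise_ne hop
    by_cases hsx : s = x
    · subst hsx; exact hthree h1 h3.symm h2
    · by_cases hsy : s = y
      · subst hsy; exact hthree h2 h1.symm h3
      · exact hthree hsx hsy h1
  rw [← hT, ← hT']
  exact_mod_cast hs

theorem dist_le (hf : X.MoebiusEquiv Y f) {u v : V} {u' v' : W}
    (hu : X.Corresponds Y f u u') (hv : X.Corresponds Y f v v') :
    X.graph.dist u v ≤ Y.graph.dist u' v' := by
  -- one of the opposite points of the triple at `u` is on the far side of `u` from `v`
  obtain ⟨t, ht⟩ : ∃ t : A, X.towards u v t = X.graph.dist u v := by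
    obtain ⟨x, y, z, hop, -⟩ := hu
    rcases hf.left.exists_separators_subset hop v with h | h
    exacts [⟨x, hf.left.towards_eq_dist h⟩, ⟨y, hf.left.towards_eq_dist h⟩]
  have h1 := hf.towards_add_towards hu hv t
  have h2 := hf.right.towards_le u' v' (f t)
  obtain ⟨n, hn⟩ := ENat.ne_top_iff_exists.1 (ne_top_of_le_ne_top (ENat.natCast_ne_top _) h2)
  rw [ht, ← hn] at h1
  rw [← hn] at h2
  norm_cast at h1 h2
  omega

theorem dist_eq (hf : X.MoebiusEquiv Y f) {u v : V} {u' v' : W}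
    (hu : X.Corresponds Y f u u') (hv : X.Corresponds Y f v v') :
    Y.graph.dist u' v' = X.graph.dist u v :=
  (hf.symm.dist_le hu.symm hv.symm).antisymm (hf.dist_le hu hv)

theorem corresponds_unique (hf : X.MoebiusEquiv Y f) {v : V} {v' v'' : W}
    (h : X.Corresponds Y f v v') (h' : X.Corresponds Y f v v'') : v' = v'' := by
  rw [← hf.right.connected.dist_eq_zero_iff, hf.dist_eq h h', SimpleGraph.dist_self]

theorem towards_eq (hf : X.MoebiusEquiv Y f) {u v : V} {u' v' : W}
    (hu : X.Corresponds Y f u u') (hv : X.Corresponds Y f v v') (s : A) :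
    X.towards u v s = Y.towards u' v' (f s) := by
  have h1 := hf.towards_add_towards hu hv s
  obtain ⟨n, hn⟩ := ENat.ne_top_iff_exists.1
    (ne_top_of_le_ne_top (ENat.natCast_ne_top _) (hf.left.towards_le u v s))
  obtain ⟨m, hm⟩ := ENat.ne_top_iff_exists.1
    (ne_top_of_le_ne_top (ENat.natCast_ne_top _) (hf.right.towards_le u' v' (f s)))
  rw [hf.dist_eq hu hv, ← hn, ← hm] at h1
  rw [← hn, ← hm]
  norm_cast at h1 ⊢
  omega

theorem exists_corresponds (hf : X.MoebiusEquiv Y f) {v : V} (hv : v ∈ X.orMedians) :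
    ∃ v' ∈ Y.orMedians, X.Corresponds Y f v v' := by
  obtain ⟨x, hx, y, hy, z, hz, hop⟩ := hf.left.exists_oppositeAt_of_ample hf.left_ample hv
  obtain ⟨v', hv'⟩ := hf.exists_oppositeAt (x := ⟨x, hx⟩) (y := ⟨y, hy⟩) (z := ⟨z, hz⟩) hop
  exact ⟨v', ⟨_, hf.right_regular (f ⟨x, hx⟩).2, _, hf.right_regular (f ⟨y, hy⟩).2, _,
    hf.right_regular (f ⟨z, hz⟩).2, hv'⟩, _, _, _, hop, hv'⟩

end MoebiusEquiv

end CrossRatio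

/-! ### Convergence to regular points -/

section Convergence

variable {X : CubicalComplex V} {Y : CubicalComplex W}

theorem tendsto_roller_iff {ι : Type*} {l : Filter ι} {u : ι → X.Roller} {x : X.Roller} :
    Tendsto u l (𝓝 x) ↔
      ∀ h, X.IsHalfspace h → ∀ᶠ i in l, (h ∈ (u i).halfspaces ↔ h ∈ x.halfspaces) := by
  classical
  rw [nhds_induced, tendsto_comap_iff, tendsto_pi_nhds]
  simp only [Function.comp_def, nhds_discrete, tendsto_pure, decide_eq_decide, Subtype.forall]

theorem IsCAT0.tendsto_roller_iff (hX : X.IsCAT0) {ι : Type*} {l : Filter ι} {u : ι → X.Roller}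
    {x : X.Roller} :
    Tendsto u l (𝓝 x) ↔ ∀ h ∈ x.halfspaces, ∀ᶠ i in l, h ∈ (u i).halfspaces := by
  rw [CubicalComplex.tendsto_roller_iff]
  constructor
  · intro H h hh
    filter_upwards [H h (x.isHalfspace h hh)] with i hi
    exact hi.2 hh
  · intro H h hh
    by_cases hx : h ∈ x.halfspaces
    · filter_upwards [H h hx] with i hi
      simp [hi, hx]
    · filter_upwards [H hᶜ ((hX.compl_mem_iff x hh).2 hx)] with i hi
      simp [(hX.compl_mem_iff _ hh).1 hi, hx]

/-- Gromov products with a boundary point tend to infinity along sequences that converge to it. -/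
theorem IsCAT0.eventually_le_gromovProduct (hX : X.IsCAT0) {ι : Type*} {l : Filter ι}
    {u : ι → X.Roller} {x : X.Roller} (hx : x ∈ X.boundary) (hu : Tendsto u l (𝓝 x)) (p : V)
    (N : ℕ) : ∀ᶠ i in l, (N : ℕ∞) ≤ X.gromovProduct p x (u i) := by
  have htop := hX.gromovProduct_self p hx
  obtain ⟨S, hS, hSN⟩ : ∃ S ⊆ {h | h ∈ x.halfspaces ∧ h ∈ x.halfspaces ∧ p ∉ h}, S.encard = N :=
    Set.exists_subset_encard_eq (by rw [← gromovProduct, htop]; exact le_top)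
  have hSfin : S.Finite := Set.finite_of_encard_eq_coe hSN
  have := (hSfin.eventually_all (l := l) (p := fun h i => h ∈ (u i).halfspaces)).2
    fun h hh => hX.tendsto_roller_iff.1 hu h (hS hh).1
  filter_upwards [this] with i hi
  rw [← hSN]
  exact Set.encard_le_encard fun h hh => ⟨(hS hh).1, hi h hh, (hS hh).2.2⟩

/-- Conversely, unbounded Gromov products with a regular point force convergence. -/
theorem IsCAT0.tendsto_of_eventually_le_gromovProduct (hX : X.IsCAT0) {ι : Type*} {l : Filter ι}
    {u : ι → X.Roller} {x : X.Roller} (hx : x ∈ X.regularBoundary) (p : V)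
    (hu : ∀ N : ℕ, ∀ᶠ i in l, (N : ℕ∞) ≤ X.gromovProduct p x (u i)) : Tendsto u l (𝓝 x) := by
  obtain ⟨h, hh⟩ := exists_isRegularChain hx
  rw [hX.tendsto_roller_iff]
  intro k hk
  obtain ⟨n, hn⟩ := hh.exists_subset hX hk
  obtain ⟨N, hN⟩ := hh.exists_gromovProduct_le hX p n
  filter_upwards [hu (N + 1)] with i hi
  refine hX.mem_of_subset (h := h n) ?_ (x.isHalfspace k hk) hn
  by_contra hcon
  have := hi.trans (hN _ hcon)
  norm_cast at this
  omega

theorem MoebiusEquiv.tendsto {A : Set X.Roller} {B : Set Y.Roller} {f : A ≃ B}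
    (hf : X.MoebiusEquiv Y f) {v : ℕ → V} {v' : ℕ → W} (hv : ∀ n, X.Corresponds Y f (v n) (v' n))
    {w : A} (hw : Tendsto (fun n => X.ofVertex (v n)) atTop (𝓝 w)) :
    Tendsto (fun n => Y.ofVertex (v' n)) atTop (𝓝 (f w : Y.Roller)) := by
  refine hf.right.tendsto_of_eventually_le_gromovProduct (hf.right_regular (f w).2) (v' 0)
    fun N => ?_
  filter_upwards [hf.left.eventually_le_gromovProduct (hf.left_regular w.2).1 hw (v 0) N] with n hn
  rwa [gromovProduct_comm, gromovProduct_ofVertex_left, ← hf.towards_eq (hv n) (hv 0) w,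
    ← gromovProduct_ofVertex_left, gromovProduct_comm]

end Convergence

/-! ### Isomorphisms -/

section Isomorphisms

variable {X : CubicalComplex V} {Y : CubicalComplex W} {Φ : V ≃ W}

theorem image_mem_map_iff (hΦ : X.IsIso Y Φ) {x : X.Roller} {h : Set V} :
    Φ '' h ∈ (Roller.map Φ hΦ x).halfspaces ↔ h ∈ x.halfspaces :=
  Φ.injective.image_injective.mem_set_image

theorem IsIso.isHalfspace_image (hΦ : X.IsIso Y Φ) {h : Set V} (hh : X.IsHalfspace h) :
    Y.IsHalfspace (Φ '' h) := by
  obtain ⟨w, hw, hs⟩ := hh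
  exact ⟨_, hΦ.isHyperplane hw, hΦ.isSide hs⟩

theorem IsIso.map_ofVertex (hΦ : X.IsIso Y Φ) (hY : Y.IsCAT0) (v : V) :
    Roller.map Φ hΦ (X.ofVertex v) = Y.ofVertex (Φ v) := by
  refine hY.roller_eq ?_
  rintro _ ⟨k, ⟨hk, hv⟩, rfl⟩
  exact ⟨hΦ.isHalfspace_image hk, v, hv, rfl⟩

theorem IsIso.map_mem_interval (hΦ : X.IsIso Y Φ) {x y z : X.Roller} (hz : z ∈ X.interval x y) :
    Roller.map Φ hΦ z ∈ Y.interval (Roller.map Φ hΦ x) (Roller.map Φ hΦ y) := by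
  rintro _ ⟨k, hk, rfl⟩ h2
  exact (image_mem_map_iff hΦ).2 (hz k hk ((image_mem_map_iff hΦ).1 h2))

theorem IsIso.isMedian_map (hΦ : X.IsIso Y Φ) {x y z m : X.Roller} (hm : X.IsMedian x y z m) :
    Y.IsMedian (Roller.map Φ hΦ x) (Roller.map Φ hΦ y) (Roller.map Φ hΦ z) (Roller.map Φ hΦ m) :=
  ⟨hΦ.map_mem_interval hm.1, hΦ.map_mem_interval hm.2.1, hΦ.map_mem_interval hm.2.2⟩

theorem IsIso.gromovProduct_eq_zero (hΦ : X.IsIso Y Φ) {v : V} {x y : X.Roller}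
    (h : X.gromovProduct v x y = 0) :
    Y.gromovProduct (Φ v) (Roller.map Φ hΦ x) (Roller.map Φ hΦ y) = 0 := by
  rw [CubicalComplex.gromovProduct_eq_zero] at h ⊢
  rintro _ ⟨k, hk, rfl⟩ h2
  exact ⟨v, h k hk ((image_mem_map_iff hΦ).1 h2), rfl⟩

theorem IsIso.oppositeAt_map (hΦ : X.IsIso Y Φ) (hX : X.IsCAT0) (hY : Y.IsCAT0)
    {x y z : X.Roller} {v : V} (h : X.OppositeAt x y z v) :
    Y.OppositeAt (Roller.map Φ hΦ x) (Roller.map Φ hΦ y) (Roller.map Φ hΦ z) (Φ v) := by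
  rw [hX.oppositeAt_iff] at h
  rw [hY.oppositeAt_iff]
  refine ⟨?_, hΦ.gromovProduct_eq_zero h.2.1, hΦ.gromovProduct_eq_zero h.2.2⟩
  rintro _ ⟨j, hj, rfl⟩ _ ⟨k, hk, rfl⟩ hvj hvk hjk
  rw [← Set.image_inter Φ.injective, Set.image_nonempty] at hjk
  exact h.1 j hj k hk (fun hv => hvj ⟨v, hv, rfl⟩) (fun hv => hvk ⟨v, hv, rfl⟩) hjk

end Isomorphisms

end CubicalComplex

theorem mainTheorem9 {V : Type*} {W : Type*}
    (X : CubicalComplex V) (Y : CubicalComplex W)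
    (hX : X.IsCAT0) (hY : Y.IsCAT0) (hXf : X.LocallyFinite) (hYf : Y.LocallyFinite)
    (A : Set X.Roller) (B : Set Y.Roller)
    (hAreg : A ⊆ X.regularBoundary) (hBreg : B ⊆ Y.regularBoundary)
    (hA : X.Ample A) (hB : Y.Ample B)
    (f : A → B) (hf : Function.Bijective f) (hfM : X.IsMoebius Y f) :
    ∃ φ : X.orMedians → Y.orMedians,
      -- `φ` is determined by `f`: it is the only map that is compatible with medians of
      -- opposite triples
      ((∀ (x y z : A) (v : X.orMedians), X.OppositeAt x y z v →
          Y.IsMedian (f x) (f y) (f z) (Y.ofVertex (φ v))) ∧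
        ∀ ψ : X.orMedians → Y.orMedians,
          (∀ (x y z : A) (v : X.orMedians), X.OppositeAt x y z v →
            Y.IsMedian (f x) (f y) (f z) (Y.ofVertex (ψ v))) → ψ = φ) ∧
      -- (1) distance-preserving bijection
      Function.Bijective φ ∧
      (∀ u v : X.orMedians, Y.graph.dist (φ u : W) (φ v) = X.graph.dist (u : V) v) ∧
      -- (2) equivariance
      (∀ (Γ : Type*) [Group Γ] (ρ : Γ →* Equiv.Perm V) (ρ' : Γ →* Equiv.Perm W)
          (hρ : ∀ g, X.IsIso X (ρ g)) (hρ' : ∀ g, Y.IsIso Y (ρ' g)),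
        (∀ (g : Γ) (x : A), ∃ hx : CubicalComplex.Roller.map (ρ g) (hρ g) x ∈ A,
          (f ⟨_, hx⟩ : Y.Roller) = CubicalComplex.Roller.map (ρ' g) (hρ' g) (f x)) →
        ∀ (g : Γ) (v : X.orMedians), ∃ hv : ρ g v ∈ X.orMedians,
          (φ ⟨_, hv⟩ : W) = ρ' g (φ v)) ∧
      -- (3) `φ` extends `f`
      (∀ (v : ℕ → X.orMedians) (w : A),
        Filter.Tendsto (fun n => X.ofVertex (v n)) Filter.atTop (nhds (w : X.Roller)) →
        Filter.Tendsto (fun n => Y.ofVertex (φ (v n))) Filter.atTop (nhds (f w : Y.Roller))) ∧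
      -- (4) agreement with isomorphisms that restrict to `f`
      (∀ (Φ : V ≃ W) (hΦ : X.IsIso Y Φ),
        (∀ x : A, CubicalComplex.Roller.map Φ hΦ x = f x) →
        ∀ v : X.orMedians, (φ v : W) = Φ v) := by
  set F : A ≃ B := Equiv.ofBijective f hf
  have hF : X.MoebiusEquiv Y F := ⟨hX, hY, hXf, hYf, hAreg, hBreg, hA, hB, fun v v' x y z w =>
    hfM.gromovProduct_add hX hY hAreg hBreg hf.1 v v' x y z w⟩
  have hex : ∀ v : X.orMedians, ∃ v' : Y.orMedians, X.Corresponds Y F v v' := fun v => by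
    obtain ⟨v', hv', h⟩ := hF.exists_corresponds v.2
    exact ⟨⟨v', hv'⟩, h⟩
  choose φ hφ using hex
  have hmed : ∀ (x y z : A) (v : X.orMedians), X.OppositeAt x y z v →
      Y.IsMedian (f x) (f y) (f z) (Y.ofVertex (φ v)) := by
    intro x y z v h
    obtain ⟨v', hv'⟩ := hF.exists_oppositeAt h
    rw [hF.corresponds_unique (hφ v) ⟨x, y, z, h, hv'⟩]
    exact hv'.1
  have htriple : ∀ v : X.orMedians, ∃ x y z : A, X.OppositeAt x y z v := fun v => by
    obtain ⟨x, hx, y, hy, z, hz, h⟩ := hX.exists_oppositeAt_of_ample hA v.2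
    exact ⟨⟨x, hx⟩, ⟨y, hy⟩, ⟨z, hz⟩, h⟩
  have hdist : ∀ u v : X.orMedians, Y.graph.dist (φ u : W) (φ v) = X.graph.dist (u : V) v :=
    fun u v => hF.dist_eq (hφ u) (hφ v)
  refine ⟨φ, ⟨hmed, fun ψ hψ => ?_⟩, ⟨fun u v huv => ?_, fun v' => ?_⟩, hdist, ?_, ?_, ?_⟩
  · funext v
    obtain ⟨x, y, z, h⟩ := htriple v
    exact Subtype.ext (hY.eq_of_isMedian_ofVertex (hψ x y z v h) (hmed x y z v h))
  · have h := hdist u v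
    rw [huv, SimpleGraph.dist_self] at h
    exact Subtype.ext (hX.connected.dist_eq_zero_iff.1 h.symm)
  · obtain ⟨v, hv, h⟩ := hF.symm.exists_corresponds v'.2
    exact ⟨⟨v, hv⟩, Subtype.ext (hF.corresponds_unique (hφ ⟨v, hv⟩) h.symm)⟩
  · intro Γ _ ρ ρ' hρ hρ' hequiv g v
    obtain ⟨x, y, z, h⟩ := htriple v
    obtain ⟨hx, hfx⟩ := hequiv g x
    obtain ⟨hy, hfy⟩ := hequiv g y
    obtain ⟨hz, hfz⟩ := hequiv g z
    have hop := (hρ g).oppositeAt_map hX hX h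
    have hv : ρ g v ∈ X.orMedians := ⟨_, hAreg hx, _, hAreg hy, _, hAreg hz, hop⟩
    refine ⟨hv, ?_⟩
    have h1 := hmed ⟨_, hx⟩ ⟨_, hy⟩ ⟨_, hz⟩ ⟨_, hv⟩ hop
    have h2 := (hρ' g).isMedian_map (hmed x y z v h)
    rw [hfx, hfy, hfz] at h1
    rw [(hρ' g).map_ofVertex hY] at h2
    exact hY.eq_of_isMedian_ofVertex h1 h2
  · exact fun v w hw => hF.tendsto (fun n => hφ (v n)) hw
  · intro Φ hΦ hres v
    obtain ⟨x, y, z, h⟩ := htriple v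
    have h1 := hΦ.isMedian_map h.1
    rw [hres, hres, hres, hΦ.map_ofVertex hY] at h1
    exact hY.eq_of_isMedian_ofVertex (hmed x y z v h) h1
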